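/- Let $A\in\mathbb R^{n\times n}$, $B\in\mathbb R^{n\times m}$, $C\in\mathbb R^{p\times n}$, $D\in\mathbb R^{p\times m}$, $X_0\in\mathbb R^{n\times q}$, and let the system $$\dot x(t)=Ax(t)+Bu(t),\quad x(0)=X_0z_0,\qquad y(t)=Cx(t)+Du(t),\qquad t\ge 0,$$ be asymptotically stable, i.e. all eigenvalues of $A$ have negative real part. For an input matrix $\mathcal B$ with $n$ rows and $1\le r\le n$, we write $[V_r,W_r,\sigma_1,\dots,\sigma_n]=\operatorname{BT}(A,\mathcal B,C,r)$ for balanced truncation: let $P,Q$ be the Gramians, i.e. $AP+PA^{\mathsf T}+\mathcal B\mathcal B^{\mathsf T}=0$ and $A^{\mathsf T}Q+QA+C^{\mathsf T}C=0$, factorized as $P=RR^{\mathsf T}$, $Q=LL^{\mathsf T}$ with $R,L\in\mathbb R^{n\times n}$, and let $L^{\mathsf T}R=U\operatorname{diag}(\sigma_1,\dots,\sigma_n)Z^{\mathsf T}$ be a singular value decomposition with $\sigma_1\ge\dots\ge\sigma_n\ge0$ (the Hankel singular values); with $U_r,Z_r$ the first $r$ columns of $U,Z$ and $\Sigma_r=\operatorname{diag}(\sigma_1,\dots,\sigma_r)$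 nonsingular, put $V_r=RZ_r\Sigma_r^{-1/2}$ and $W_r=LU_r\Sigma_r^{-1/2}$. Put $\sigma_{n+1}:=0$. Let $\alpha>0$, $k,\ell\ge1$, and $$[V_k,W_k,\sigma_1,\dots,\sigma_n]=\operatorname{BT}(A,B,C,k),\qquad [\hat V_\ell,\hat W_\ell,\theta_1,\dots,\theta_n]=\operatorname{BT}\Big(A,\tfrac1{\sqrt{2\alpha}}(A+\alpha I_n)X_0,C,\ell\Big),$$ for any choice of the factors and of the singular value decompositions. Put $A_k=W_k^{\mathsf T}AV_k$, $B_k=W_k^{\mathsf T}B$, $C_k=CV_k$, $\hat A_\ell=\hat W_\ell^{\mathsf T}A\hat V_\ell$, $\hat C_\ell=C\hat V_\ell$. Suppose that $\sigma_k>\sigma_{k+1}$, $\theta_\ell>\theta_{\ell+1}$ and that $-\alpha$ is not an eigenvalue of $\hat A_\ell$, and put $X_{0,\ell}=(\hat A_\ell+\alpha I_\ell)^{-1}\hat W_\ell^{\mathsf T}(A+\alpha I_n)X_0$ and $\hat F_\ell=CX_0-\hat C_\ell X_{0,\ell}$. Consider the reduced-order model $$\begin{bmatrix}\dot x_k\\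 \dot{\hat x}_\ell\end{bmatrix}=\begin{bmatrix}A_k&0\\0&\hat A_\ell\end{bmatrix}\begin{bmatrix}x_k\\ \hat x_\ell\end{bmatrix}+\begin{bmatrix}B_k\\0\end{bmatrix}u,\quad \begin{bmatrix}x_k(0)\\ \hat x_\ell(0)\end{bmatrix}=\begin{bmatrix}0\\X_{0,\ell}z_0\end{bmatrix},\qquad y_r(t)=\begin{bmatrix}C_k&\hat C_\ell\end{bmatrix}\begin{bmatrix}x_k(t)\\ \hat x_\ell(t)\end{bmatrix}+Du(t)+\hat F_\ell z_0e^{-\alpha t}.$$ Then the reduced-order model is asymptotically stable, i.e. all eigenvalues of $\operatorname{diag}(A_k,\hat A_\ell)$ have negative real part. For all $z_0\in\mathbb R^q$ and all inputs $u$ (solutions being understood in the integrated sense) we have $y_r(0)=y(0)$, and if $u\in\mathbb L_2([0,\infty),\mathbb R^m)$, then $y-y_r\in\mathbb L_2([0,\infty),\mathbb R^p)$ and $$\|y-y_r\|_{\mathbb L_2}\le 2(\sigma_{k+1}+\dots+\sigma_n)\|u\|_{\mathbb L_2}+2(\theta_{\ell+1}+\dots+\theta_n)\|z_0\|_2 .$$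 -/

import Mathlib

open MeasureTheory Matrix

noncomputable section

namespace ShiftBT

/-- Asymptotic stability of `x' = A x`: all (complex) eigenvalues of the real matrix `A` lie in the
open left half-plane. -/
def IsAsymptoticallyStable {ι : Type*} [Fintype ι] [DecidableEq ι] (A : Matrix ι ι ℝ) : Prop :=
  ∀ μ ∈ spectrum ℂ (A.map (fun a : ℝ => (a : ℂ))), μ.re < 0

/-- `x` is the (Carathéodory) solution on `[0, ∞)` of `x' = A x + B u`, `x(0) = x₀`, in integrated
form. Only the values of `u` and `x` on `[0, ∞)` matter. -/
structure IsTrajectory {ι κ : Type*} [Fintype ι] [Fintype κ]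
    (A : Matrix ι ι ℝ) (B : Matrix ι κ ℝ) (u : ℝ → κ → ℝ) (x₀ : ι → ℝ) (x : ℝ → ι → ℝ) : Prop where
  continuousOn : ContinuousOn x (Set.Ici 0)
  intervalIntegrable : ∀ t, 0 ≤ t →
    IntervalIntegrable (fun s => A *ᵥ x s + B *ᵥ u s) volume 0 t
  eq_integral : ∀ t, 0 ≤ t → x t = x₀ + ∫ s in (0 : ℝ)..t, (A *ᵥ x s + B *ᵥ u s)

/-- `g ∈ L₂([0, ∞), ℝ^κ)`, where `ℝ^κ` carries the Euclidean norm. -/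
def MemL2 {κ : Type*} [Fintype κ] (g : ℝ → κ → ℝ) : Prop :=
  MemLp (fun t => WithLp.toLp 2 (g t)) 2 (volume.restrict (Set.Ici (0 : ℝ)))

/-- The norm `(∫₀^∞ g(t)ᵀ g(t) dt)^{1/2}` of `L₂([0, ∞), ℝ^κ)`. -/
def normL2 {κ : Type*} [Fintype κ] (g : ℝ → κ → ℝ) : ℝ :=
  Real.sqrt (∫ t in Set.Ici (0 : ℝ), g t ⬝ᵥ g t)

/-- `[V, W, σ₁, …, σₙ] = BT(A, B, C, r)`: balanced truncation by the square-root method.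
`P`, `Q` are the controllability and the observability Gramian, `P = R Rᵀ`, `Q = L Lᵀ`, and
`Lᵀ R = U diag(σ₁, …, σₙ) Zᵀ` is a singular value decomposition, so the `σᵢ` are the Hankel
singular values (the `σᵢ²` are the eigenvalues of `P Q`). The projection matrices are
`V = R Z_r Σ_r^{-1/2}` and `W = L U_r Σ_r^{-1/2}`, with the leading `r` columns `Z_r`, `U_r` of `Z`,
`U` and `Σ_r = diag(σ₁, …, σ_r)`. The factors and the decomposition are not unique; every choice is
admitted (low-rank factors with fewer than `n` columns are filled up with zero columns). The sequence
is indexed from `1`, with `σᵢ = 0` for `i > n` by convention. -/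
def IsBalancedTruncation {n m p : ℕ} (A : Matrix (Fin n) (Fin n) ℝ) (B : Matrix (Fin n) (Fin m) ℝ)
    (C : Matrix (Fin p) (Fin n) ℝ) (r : ℕ) (V W : Matrix (Fin n) (Fin r) ℝ) (σ : ℕ → ℝ) : Prop :=
  ∃ hr : r ≤ n, ∃ P Q R L U Z : Matrix (Fin n) (Fin n) ℝ,
    A * P + P * Aᵀ + B * Bᵀ = 0 ∧
    Aᵀ * Q + Q * A + Cᵀ * C = 0 ∧
    P = R * Rᵀ ∧ Q = L * Lᵀ ∧
    U ∈ Matrix.orthogonalGroup (Fin n) ℝ ∧ Z ∈ Matrix.orthogonalGroup (Fin n) ℝ ∧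
    Lᵀ * R = U * Matrix.diagonal (fun i : Fin n => σ (i + 1)) * Zᵀ ∧
    (∀ i, 0 ≤ σ i) ∧ (∀ i j, 1 ≤ i → i ≤ j → σ j ≤ σ i) ∧ (∀ i, n < i → σ i = 0) ∧
    V = R * Z.submatrix id (Fin.castLE hr) *
      Matrix.diagonal (fun i : Fin r => (Real.sqrt (σ (i + 1)))⁻¹) ∧
    W = L * U.submatrix id (Fin.castLE hr) *
      Matrix.diagonal (fun i : Fin r => (Real.sqrt (σ (i + 1)))⁻¹)

/-- The shifted input matrix `(A + α I) X₀ / √(2α)`. -/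
def shiftedInput {n q : ℕ} (A : Matrix (Fin n) (Fin n) ℝ) (X₀ : Matrix (Fin n) (Fin q) ℝ) (α : ℝ) :
    Matrix (Fin n) (Fin q) ℝ :=
  (1 / Real.sqrt (2 * α)) • ((A + α • (1 : Matrix (Fin n) (Fin n) ℝ)) * X₀)

/-- The projected state matrix `Wᵀ A V`. -/
def redA {n r : ℕ} (A : Matrix (Fin n) (Fin n) ℝ) (V W : Matrix (Fin n) (Fin r) ℝ) :
    Matrix (Fin r) (Fin r) ℝ :=
  Wᵀ * A * V

/-- The reduced initial value matrix `(Â + α I)⁻¹ Ŵᵀ (A + α I) X₀` with `Â = Ŵᵀ A V̂`. -/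
def redX₀ {n q l : ℕ} (A : Matrix (Fin n) (Fin n) ℝ) (X₀ : Matrix (Fin n) (Fin q) ℝ) (α : ℝ)
    (V' W' : Matrix (Fin n) (Fin l) ℝ) : Matrix (Fin l) (Fin q) ℝ :=
  (redA A V' W' + α • (1 : Matrix (Fin l) (Fin l) ℝ))⁻¹ * W'ᵀ *
    (A + α • (1 : Matrix (Fin n) (Fin n) ℝ)) * X₀

/-- The matrix `F̂ = C X₀ - Ĉ X₀,ₗ` with `Ĉ = C V̂`. -/
def redF {n p q l : ℕ} (A : Matrix (Fin n) (Fin n) ℝ) (C : Matrix (Fin p) (Fin n) ℝ)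
    (X₀ : Matrix (Fin n) (Fin q) ℝ) (α : ℝ) (V' W' : Matrix (Fin n) (Fin l) ℝ) :
    Matrix (Fin p) (Fin q) ℝ :=
  C * X₀ - C * V' * redX₀ A X₀ α V' W'

/-- The state matrix `diag(A_k, Âₗ)` of the separate-projection model. -/
def romA {n k l : ℕ} (A : Matrix (Fin n) (Fin n) ℝ) (V W : Matrix (Fin n) (Fin k) ℝ)
    (V' W' : Matrix (Fin n) (Fin l) ℝ) : Matrix (Fin k ⊕ Fin l) (Fin k ⊕ Fin l) ℝ :=
  Matrix.fromBlocks (redA A V W) 0 0 (redA A V' W')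

/-- The input matrix `[Wᵀ B; 0]` of the separate-projection model. -/
def romB {n m k : ℕ} (l : ℕ) (B : Matrix (Fin n) (Fin m) ℝ) (W : Matrix (Fin n) (Fin k) ℝ) :
    Matrix (Fin k ⊕ Fin l) (Fin m) ℝ :=
  Matrix.fromRows (Wᵀ * B) 0

/-- The output matrix `[C V, C V̂]` of the separate-projection model. -/
def romC {n p k l : ℕ} (C : Matrix (Fin p) (Fin n) ℝ) (V : Matrix (Fin n) (Fin k) ℝ)
    (V' : Matrix (Fin n) (Fin l) ℝ) : Matrix (Fin p) (Fin k ⊕ Fin l) ℝ :=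
  Matrix.fromCols (C * V) (C * V')

/-- The initial state `(0, X₀,ₗ z₀)` of the separate-projection model. -/
def romInit {n q l : ℕ} (k : ℕ) (A : Matrix (Fin n) (Fin n) ℝ) (X₀ : Matrix (Fin n) (Fin q) ℝ)
    (α : ℝ) (V' W' : Matrix (Fin n) (Fin l) ℝ) (z₀ : Fin q → ℝ) : Fin k ⊕ Fin l → ℝ :=
  Sum.elim 0 (redX₀ A X₀ α V' W' *ᵥ z₀)

end ShiftBT

end

/-!
Suppose that both Gramians of a system are equal to `S` and that `S` acts as the scalar `s` on the
states which are removed from it. With the full state `x`, the embedded reduced state `ξ`,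
`z = x - ξ` and `w = x + ξ`, the function `z ⬝ᵥ S z + s² w ⬝ᵥ S⁻¹ w` starts at `0`, is nonnegative,
and by the two Lyapunov equations its derivative is at most `4 s² |u|² - |C z|²`. Hence the removal
costs at most `2 s ‖u‖`. States with singular value `0` are uncontrollable or unobservable and cost
nothing, so removing the others one at a time and using the triangle inequality gives twice the sum
of the discarded singular values.

The reduced model is stable by the argument of Pernebo and Silverman. On an eigenspace of its state
matrix for `μ` with `0 ≤ re μ` the Lyapunov equations force `C w = 0` and `Bᵀ S w = 0` and make the
eigenspace invariant under `S²`. A common eigenvector lifts to an eigenvector of `A` for `μ`,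
because no retained singular value equals a discarded one.

Finally, `x(t) - e^{-αt} x(0)` is the response from rest of the system with the shifted input matrix
to `√(2α) e^{-αt} z₀`, an input of norm at most `‖z₀‖`. The initial value of the second reduced
model is chosen such that the same holds for it.
-/

namespace ShiftBT

variable {ι κ η ρ τ : Type*} [Fintype ι] [Fintype κ] [Fintype η] [Fintype ρ] [Fintype τ]

section L2

theorem norm_toLp_sq (v : κ → ℝ) : ‖WithLp.toLp 2 v‖ ^ 2 = v ⬝ᵥ v := by
  rw [EuclideanSpace.real_norm_sq_eq]
  simp [dotProduct, sq]

theorem MemL2.integrableOn_dotProduct_self {g : ℝ → κ → ℝ} (hg : MemL2 g) :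
    IntegrableOn (fun t => g t ⬝ᵥ g t) (Set.Ici 0) := by
  have h : MemLp (fun t => WithLp.toLp 2 (g t)) 2 (volume.restrict (Set.Ici 0)) := hg
  simpa [IntegrableOn, norm_toLp_sq] using h.integrable_norm_pow (by simp)

theorem MemL2.normL2_eq_toReal_eLpNorm {g : ℝ → κ → ℝ} (hg : MemL2 g) :
    normL2 g =
      (eLpNorm (fun t => WithLp.toLp 2 (g t)) 2 (volume.restrict (Set.Ici 0))).toReal := by
  have h : MemLp (fun t => WithLp.toLp 2 (g t)) 2 (volume.restrict (Set.Ici 0)) := hg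
  rw [h.eLpNorm_eq_integral_rpow_norm (by simp) (by simp),
    ENNReal.toReal_ofReal (by positivity), normL2, Real.sqrt_eq_rpow]
  simp [norm_toLp_sq]

theorem MemL2.intervalIntegrable {g : ℝ → κ → ℝ} (hg : MemL2 g) (T : ℝ) (hT : 0 ≤ T) :
    IntervalIntegrable g volume 0 T := by
  rw [intervalIntegrable_iff_integrableOn_Ioc_of_le hT]
  have hloc : MemLp (fun t => WithLp.toLp 2 (g t)) 2 (volume.restrict (Set.Ioc 0 T)) :=
    MemLp.mono_measure (Measure.restrict_mono (fun _ ht => ht.1.le) le_rfl) hg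
  exact (PiLp.continuousLinearEquiv 2 ℝ fun _ : κ => ℝ).toContinuousLinearMap.integrable_comp
    (hloc.integrable (by norm_num))

theorem MemL2.intervalIntegral_dotProduct_self_le {g : ℝ → κ → ℝ} (hg : MemL2 g) {T : ℝ}
    (hT : 0 ≤ T) : ∫ t in (0 : ℝ)..T, g t ⬝ᵥ g t ≤ normL2 g ^ 2 := by
  have hnonneg : ∀ t, 0 ≤ g t ⬝ᵥ g t := fun t => dotProduct_star_self_nonneg (g t)
  rw [normL2, Real.sq_sqrt (integral_nonneg hnonneg), intervalIntegral.integral_of_le hT]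
  exact setIntegral_mono_set hg.integrableOn_dotProduct_self (.of_forall hnonneg)
    (LE.le.eventuallyLE fun _ ht => ht.1.le)

/-- `g ∈ L₂([0, ∞), ℝ^κ)` and `‖g‖ ≤ K`. The membership is recorded together with the bound, since
`normL2` is the junk value `0` on functions that are not square integrable. -/
def NormL2LE (g : ℝ → κ → ℝ) (K : ℝ) : Prop :=
  MemL2 g ∧ normL2 g ≤ K

theorem NormL2LE.mono {g : ℝ → κ → ℝ} {K K' : ℝ} (hg : NormL2LE g K) (h : K ≤ K') :
    NormL2LE g K' :=
  ⟨hg.1, hg.2.trans h⟩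

theorem NormL2LE.congr {g g' : ℝ → κ → ℝ} {K : ℝ} (hg : NormL2LE g K)
    (h : ∀ t, 0 ≤ t → g' t = g t) : NormL2LE g' K := by
  refine ⟨MemLp.ae_eq ?_ hg.1, ?_⟩
  · filter_upwards [ae_restrict_mem measurableSet_Ici] with t ht
    rw [h t ht]
  · have hint : ∫ t in Set.Ici (0 : ℝ), g' t ⬝ᵥ g' t = ∫ t in Set.Ici (0 : ℝ), g t ⬝ᵥ g t :=
      setIntegral_congr_fun measurableSet_Ici fun t ht => by simp only [h t ht]
    rw [normL2, hint]
    exact hg.2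

theorem NormL2LE.add {g g' : ℝ → κ → ℝ} {K K' : ℝ} (hg : NormL2LE g K) (hg' : NormL2LE g' K') :
    NormL2LE (fun t => g t + g' t) (K + K') := by
  have hadd : MemL2 fun t => g t + g' t := MemLp.add hg.1 hg'.1
  refine ⟨hadd, ?_⟩
  calc normL2 (fun t => g t + g' t)
      ≤ normL2 g + normL2 g' := by
        rw [hadd.normL2_eq_toReal_eLpNorm, hg.1.normL2_eq_toReal_eLpNorm,
          hg'.1.normL2_eq_toReal_eLpNorm, ← ENNReal.toReal_add hg.1.2.ne hg'.1.2.ne]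
        exact ENNReal.toReal_mono (ENNReal.add_ne_top.2 ⟨hg.1.2.ne, hg'.1.2.ne⟩)
          (eLpNorm_add_le hg.1.1 hg'.1.1 one_le_two)
    _ ≤ K + K' := add_le_add hg.2 hg'.2

theorem NormL2LE.of_intervalIntegral_le {g : ℝ → κ → ℝ} {K : ℝ}
    (hg : ContinuousOn g (Set.Ici 0)) (hK : 0 ≤ K)
    (h : ∀ T, 0 ≤ T → ∫ t in (0 : ℝ)..T, g t ⬝ᵥ g t ≤ K ^ 2) : NormL2LE g K := by
  have hgg : ContinuousOn (fun t => g t ⬝ᵥ g t) (Set.Ici 0) := by fun_prop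
  have hnonneg : ∀ t, 0 ≤ g t ⬝ᵥ g t := fun t => dotProduct_star_self_nonneg (g t)
  have hint : IntegrableOn (fun t => g t ⬝ᵥ g t) (Set.Ioi 0) := by
    refine integrableOn_Ioi_of_intervalIntegral_norm_bounded (K ^ 2) 0 (b := id) (l := Filter.atTop)
      (fun T => ?_) Filter.tendsto_id ?_
    · exact ((hgg.mono Set.Icc_subset_Ici_self).integrableOn_Icc).mono_set Set.Ioc_subset_Icc_self
    · filter_upwards [Filter.eventually_ge_atTop 0] with T hT
      simpa only [Real.norm_of_nonneg (hnonneg _), id] using h T hT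
  have hle : ∫ t in Set.Ioi (0 : ℝ), g t ⬝ᵥ g t ≤ K ^ 2 :=
    le_of_tendsto (intervalIntegral_tendsto_integral_Ioi 0 hint Filter.tendsto_id)
      ((Filter.eventually_ge_atTop 0).mono h)
  have hLp : ContinuousOn (fun t => WithLp.toLp 2 (g t)) (Set.Ici 0) :=
    (PiLp.continuous_toLp 2 fun _ : κ => ℝ).comp_continuousOn hg
  refine ⟨(memLp_two_iff_integrable_sq_norm (hLp.aestronglyMeasurable measurableSet_Ici)).2 ?_, ?_⟩
  · simpa only [norm_toLp_sq, IntegrableOn, restrict_Ioi_eq_restrict_Ici] using hint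
  · rw [normL2, integral_Ici_eq_integral_Ioi]
    exact Real.sqrt_le_iff.2 ⟨hK, hle⟩

theorem normL2LE_exp_smul {α : ℝ} (hα : 0 < α) (z : κ → ℝ) :
    NormL2LE (fun t => (Real.sqrt (2 * α) * Real.exp (-α * t)) • z) ‖WithLp.toLp 2 z‖ := by
  refine .of_intervalIntegral_le (by fun_prop) (norm_nonneg _) fun T _ => ?_
  have hsq : ∀ t : ℝ, ((Real.sqrt (2 * α) * Real.exp (-α * t)) • z) ⬝ᵥ
      ((Real.sqrt (2 * α) * Real.exp (-α * t)) • z) =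
      2 * α * Real.exp (-(2 * α) * t) * (z ⬝ᵥ z) := fun t => by
    have hexp : Real.exp (-(2 * α) * t) = Real.exp (-α * t) * Real.exp (-α * t) := by
      rw [← Real.exp_add]; ring_nf
    have hsqrt := Real.mul_self_sqrt (show 0 ≤ 2 * α by linarith)
    rw [smul_dotProduct, dotProduct_smul, smul_eq_mul, smul_eq_mul, hexp]
    linear_combination (Real.exp (-α * t) * Real.exp (-α * t) * (z ⬝ᵥ z)) * hsqrt
  have hderiv : ∀ t ∈ Set.uIcc 0 T, HasDerivAt (fun s => -Real.exp (-(2 * α) * s) * (z ⬝ᵥ z))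
      (2 * α * Real.exp (-(2 * α) * t) * (z ⬝ᵥ z)) t := fun t _ => by
    convert! (((hasDerivAt_id t).const_mul (-(2 * α))).exp.neg.mul_const (z ⬝ᵥ z)) using 1
    simp only [id_eq]
    ring
  simp only [hsq]
  rw [intervalIntegral.integral_eq_sub_of_hasDerivAt hderiv
    (Continuous.intervalIntegrable (by fun_prop) _ _), norm_toLp_sq]
  have hz : 0 ≤ z ⬝ᵥ z := dotProduct_star_self_nonneg z
  have hpos : 0 ≤ Real.exp (-(2 * α) * T) * (z ⬝ᵥ z) := by positivity
  simp only [mul_zero, Real.exp_zero]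
  linarith

end L2

section Primitives

variable {E F : Type*} [NormedAddCommGroup E] [NormedSpace ℝ E]
  [NormedAddCommGroup F] [NormedSpace ℝ F]

/-- `x` is continuous on `[0, ∞)` and an indefinite integral of `f` there, i.e. a Carathéodory
solution of `x' = f`. -/
structure IsPrimitive (f x : ℝ → E) : Prop where
  continuousOn : ContinuousOn x (Set.Ici 0)
  intervalIntegrable : ∀ t, 0 ≤ t → IntervalIntegrable f volume 0 t
  eq_add_integral : ∀ t, 0 ≤ t → x t = x 0 + ∫ s in (0 : ℝ)..t, f s

theorem isTrajectory_iff {A : Matrix ι ι ℝ} {B : Matrix ι κ ℝ} {u : ℝ → κ → ℝ} {x₀ : ι → ℝ}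
    {x : ℝ → ι → ℝ} :
    IsTrajectory A B u x₀ x ↔ x 0 = x₀ ∧ IsPrimitive (fun t => A *ᵥ x t + B *ᵥ u t) x := by
  constructor
  · rintro ⟨hc, hi, hx⟩
    have h0 : x 0 = x₀ := by simpa using hx 0 le_rfl
    exact ⟨h0, hc, hi, by rwa [h0]⟩
  · rintro ⟨rfl, hc, hi, hx⟩
    exact ⟨hc, hi, hx⟩

namespace IsPrimitive

theorem congr {f f' x : ℝ → E} (hx : IsPrimitive f x) (hf : ∀ t, 0 < t → f' t = f t) :
    IsPrimitive f' x where
  continuousOn := hx.continuousOn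
  intervalIntegrable t ht := (hx.intervalIntegrable t ht).congr fun s hs =>
    (hf s (Set.uIoc_of_le ht ▸ hs).1).symm
  eq_add_integral t ht := by
    rw [hx.eq_add_integral t ht, intervalIntegral.integral_congr_ae (.of_forall fun s hs => ?_)]
    exact (hf s (Set.uIoc_of_le ht ▸ hs).1).symm

theorem of_hasDerivAt [CompleteSpace E] {f x : ℝ → E} (hf : Continuous f)
    (hx : ∀ t, HasDerivAt x (f t) t) : IsPrimitive f x where
  continuousOn t _ := (hx t).continuousAt.continuousWithinAt
  intervalIntegrable t _ := hf.intervalIntegrable 0 t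
  eq_add_integral t _ := by
    rw [intervalIntegral.integral_eq_sub_of_hasDerivAt (fun s _ => hx s)
      (hf.intervalIntegrable 0 t), add_sub_cancel]

theorem add {f g x y : ℝ → E} (hx : IsPrimitive f x) (hy : IsPrimitive g y) :
    IsPrimitive (fun t => f t + g t) (fun t => x t + y t) where
  continuousOn := hx.continuousOn.add hy.continuousOn
  intervalIntegrable t ht := (hx.intervalIntegrable t ht).add (hy.intervalIntegrable t ht)
  eq_add_integral t ht := by
    rw [intervalIntegral.integral_add (hx.intervalIntegrable t ht) (hy.intervalIntegrable t ht),
      hx.eq_add_integral t ht, hy.eq_add_integral t ht, add_add_add_comm]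

theorem sub {f g x y : ℝ → E} (hx : IsPrimitive f x) (hy : IsPrimitive g y) :
    IsPrimitive (fun t => f t - g t) (fun t => x t - y t) where
  continuousOn := hx.continuousOn.sub hy.continuousOn
  intervalIntegrable t ht := (hx.intervalIntegrable t ht).sub (hy.intervalIntegrable t ht)
  eq_add_integral t ht := by
    rw [intervalIntegral.integral_sub (hx.intervalIntegrable t ht) (hy.intervalIntegrable t ht),
      hx.eq_add_integral t ht, hy.eq_add_integral t ht, add_sub_add_comm]

theorem sum {f x : ι → ℝ → E} (hx : ∀ i, IsPrimitive (f i) (x i)) :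
    IsPrimitive (fun t => ∑ i, f i t) (fun t => ∑ i, x i t) where
  continuousOn := continuousOn_finsetSum _ fun i _ => (hx i).continuousOn
  intervalIntegrable t ht := by
    simpa only [Finset.sum_fn] using
      IntervalIntegrable.sum Finset.univ fun i _ => (hx i).intervalIntegrable t ht
  eq_add_integral t ht := by
    rw [intervalIntegral.integral_finsetSum fun i _ => (hx i).intervalIntegrable t ht,
      ← Finset.sum_add_distrib]
    exact Finset.sum_congr rfl fun i _ => (hx i).eq_add_integral t ht

theorem clm [CompleteSpace E] [CompleteSpace F] (L : E →L[ℝ] F) {f x : ℝ → E}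
    (hx : IsPrimitive f x) : IsPrimitive (fun t => L (f t)) (fun t => L (x t)) where
  continuousOn := L.continuous.comp_continuousOn hx.continuousOn
  intervalIntegrable t ht := ⟨L.integrable_comp (hx.intervalIntegrable t ht).1,
    L.integrable_comp (hx.intervalIntegrable t ht).2⟩
  eq_add_integral t ht := by
    rw [L.intervalIntegral_comp_comm (hx.intervalIntegrable t ht), ← map_add,
      ← hx.eq_add_integral t ht]

theorem const_mul {f x : ℝ → ℝ} (c : ℝ) (hx : IsPrimitive f x) :
    IsPrimitive (fun t => c * f t) (fun t => c * x t) :=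
  hx.clm (ContinuousLinearMap.mul ℝ ℝ c)

theorem mulVec (M : Matrix κ ι ℝ) {f x : ℝ → ι → ℝ} (hx : IsPrimitive f x) :
    IsPrimitive (fun t => M *ᵥ f t) (fun t => M *ᵥ x t) :=
  hx.clm M.mulVecLin.toContinuousLinearMap

theorem mul {f g x y : ℝ → ℝ} (hx : IsPrimitive f x) (hy : IsPrimitive g y) :
    IsPrimitive (fun t => f t * y t + x t * g t) (fun t => x t * y t) where
  continuousOn := hx.continuousOn.mul hy.continuousOn
  intervalIntegrable t ht := by
    have hsub : Set.uIcc 0 t ⊆ Set.Ici 0 := by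
      rw [Set.uIcc_of_le ht]; exact Set.Icc_subset_Ici_self
    exact ((hx.intervalIntegrable t ht).mul_continuousOn (hy.continuousOn.mono hsub)).add
      ((hy.intervalIntegrable t ht).continuousOn_mul (hx.continuousOn.mono hsub))
  eq_add_integral t ht := by
    have hac (c : ℝ) {f : ℝ → ℝ} (hf : IntervalIntegrable f volume 0 t) :
        AbsolutelyContinuousOnInterval (fun s => c + ∫ r in (0 : ℝ)..s, f r) 0 t :=
      (LipschitzWith.const c).lipschitzOnWith.absolutelyContinuousOnInterval.add
        (hf.absolutelyContinuousOnInterval_intervalIntegral Set.left_mem_uIcc)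
    have hf := hx.intervalIntegrable t ht
    have hg := hy.intervalIntegrable t ht
    have hprod := AbsolutelyContinuousOnInterval.integral_deriv_mul_eq_sub
      (hac (x 0) hf) (hac (y 0) hg)
    simp only [intervalIntegral.integral_same, add_zero, ← hx.eq_add_integral t ht,
      ← hy.eq_add_integral t ht] at hprod
    rw [← sub_eq_iff_eq_add', ← hprod]
    apply intervalIntegral.integral_congr_ae
    filter_upwards [hf.ae_hasDerivAt_integral, hg.ae_hasDerivAt_integral] with s hfs hgs hs
    have hs' := Set.uIoc_subset_uIcc hs
    rw [((hfs hs' 0 Set.left_mem_uIcc).const_add (x 0)).deriv,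
      ((hgs hs' 0 Set.left_mem_uIcc).const_add (y 0)).deriv]
    have hs0 : 0 ≤ s := (Set.uIoc_of_le ht ▸ hs).1.le
    rw [hx.eq_add_integral s hs0, hy.eq_add_integral s hs0]

theorem dotProduct {f g x y : ℝ → ι → ℝ} (hx : IsPrimitive f x) (hy : IsPrimitive g y) :
    IsPrimitive (fun t => f t ⬝ᵥ y t + x t ⬝ᵥ g t) (fun t => x t ⬝ᵥ y t) := by
  simp only [_root_.dotProduct, ← Finset.sum_add_distrib]
  exact .sum fun i => (hx.clm (ContinuousLinearMap.proj (φ := fun _ : ι => ℝ) i)).mul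
    (hy.clm (ContinuousLinearMap.proj (φ := fun _ : ι => ℝ) i))

theorem quadraticForm {M : Matrix ι ι ℝ} (hM : M.IsHermitian) {f x : ℝ → ι → ℝ}
    (hx : IsPrimitive f x) :
    IsPrimitive (fun t => 2 * (f t ⬝ᵥ M *ᵥ x t)) (fun t => x t ⬝ᵥ M *ᵥ x t) := by
  refine (hx.dotProduct (hx.mulVec M)).congr fun t _ => ?_
  have hsymm : x t ⬝ᵥ M *ᵥ f t = f t ⬝ᵥ M *ᵥ x t := by
    rw [dotProduct_mulVec, ← mulVec_transpose, ← conjTranspose_eq_transpose_of_trivial, hM.eq,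
      dotProduct_comm]
  rw [hsymm, two_mul]

end IsPrimitive

theorem normL2LE_of_dissipation {u : ℝ → κ → ℝ} (hu : MemL2 u) {e : ℝ → η → ℝ}
    (he : ContinuousOn e (Set.Ici 0)) {γ : ℝ} (hγ : 0 ≤ γ) {φ' φ : ℝ → ℝ}
    (hφ : IsPrimitive φ' φ) (hφ0 : φ 0 = 0) (hφ_nonneg : ∀ t, 0 ≤ t → 0 ≤ φ t)
    (hφ' : ∀ t, 0 ≤ t → φ' t ≤ γ ^ 2 * (u t ⬝ᵥ u t) - e t ⬝ᵥ e t) :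
    NormL2LE e (γ * normL2 u) := by
  refine .of_intervalIntegral_le he (mul_nonneg hγ (Real.sqrt_nonneg _)) fun T hT => ?_
  have hsub : Set.uIcc 0 T ⊆ Set.Ici 0 := by
    rw [Set.uIcc_of_le hT]; exact Set.Icc_subset_Ici_self
  have hee : IntervalIntegrable (fun t => e t ⬝ᵥ e t) volume 0 T :=
    ContinuousOn.intervalIntegrable (by have := he.mono hsub; fun_prop)
  have huu : IntervalIntegrable (fun t => γ ^ 2 * (u t ⬝ᵥ u t)) volume 0 T := by
    rw [intervalIntegrable_iff_integrableOn_Ioc_of_le hT]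
    exact (hu.integrableOn_dotProduct_self.mono_set fun _ ht => ht.1.le).const_mul _
  have hbalance : 0 ≤ γ ^ 2 * (∫ t in (0 : ℝ)..T, u t ⬝ᵥ u t) - ∫ t in (0 : ℝ)..T, e t ⬝ᵥ e t :=
    calc 0 ≤ φ T := hφ_nonneg T hT
      _ = ∫ t in (0 : ℝ)..T, φ' t := by rw [hφ.eq_add_integral T hT, hφ0, zero_add]
      _ ≤ ∫ t in (0 : ℝ)..T, (γ ^ 2 * (u t ⬝ᵥ u t) - e t ⬝ᵥ e t) :=
        intervalIntegral.integral_mono_on hT (hφ.intervalIntegrable T hT) (huu.sub hee)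
          fun t ht => hφ' t ht.1
      _ = _ := by
        rw [intervalIntegral.integral_sub huu hee, intervalIntegral.integral_const_mul]
  have hu_le := mul_le_mul_of_nonneg_left (hu.intervalIntegral_dotProduct_self_le hT)
    (sq_nonneg γ)
  linarith [mul_pow γ (normL2 u) 2]

end Primitives

section Existence

variable {E : Type*} [NormedAddCommGroup E] [NormedSpace ℝ E]

theorem isPrimitive_intervalIntegral {f : ℝ → E}
    (hf : ∀ t, 0 ≤ t → IntervalIntegrable f volume 0 t) :
    IsPrimitive f fun t => ∫ s in (0 : ℝ)..t, f s where
  continuousOn t ht := by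
    have ht' : (0 : ℝ) ≤ t + 1 := by linarith [Set.mem_Ici.1 ht]
    have hcont : ContinuousOn (fun t => ∫ s in (0 : ℝ)..t, f s) (Set.uIcc 0 (t + 1)) :=
      intervalIntegral.continuousOn_primitive_interval'
        (hf (t + 1) ht') Set.left_mem_uIcc
    rw [Set.uIcc_of_le ht'] at hcont
    refine (hcont t ⟨ht, by linarith⟩).mono_of_mem_nhdsWithin ?_
    rw [← Set.Ici_inter_Iic]
    exact inter_mem_nhdsWithin _ (Iic_mem_nhds (lt_add_one t))
  intervalIntegrable := hf
  eq_add_integral t _ := by rw [intervalIntegral.integral_same, zero_add]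

theorem exp_smul_mul_exp_neg_smul [CompleteSpace E] (L : E →L[ℝ] E) (t : ℝ) :
    NormedSpace.exp (t • L) * NormedSpace.exp (-t • L) = 1 := by
  let +nondep : NormedAlgebra ℚ (E →L[ℝ] E) := .restrictScalars ℚ ℝ (E →L[ℝ] E)
  have hcomm : Commute (t • L) (-t • L) := ((Commute.refl L).smul_left t).smul_right (-t)
  rw [← NormedSpace.exp_add_of_commute hcomm, ← add_smul, add_neg_cancel, zero_smul,
    NormedSpace.exp_zero]

-- Variation of constants: `ξ t = exp (t L) ∫₀ᵗ exp (-s L) g s ds`.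
theorem exists_hasDerivAt_clm_add [CompleteSpace E] (L : E →L[ℝ] E) {g : ℝ → E}
    (hg : Continuous g) : ∃ ξ : ℝ → E, ξ 0 = 0 ∧ ∀ t, HasDerivAt ξ (L (ξ t) + g t) t := by
  set S : ℝ → E →L[ℝ] E := fun t => NormedSpace.exp (t • L)
  have hderiv : ∀ t, HasDerivAt S (L * S t) t := fun t => hasDerivAt_exp_smul_const' L t
  have hcont : Continuous S := continuous_iff_continuousAt.2 fun t => (hderiv t).continuousAt
  have hint : Continuous fun s => S (-s) (g s) := (hcont.comp continuous_neg).clm_apply hg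
  refine ⟨fun t => S t (∫ s in (0 : ℝ)..t, S (-s) (g s)), by simp, fun t => ?_⟩
  convert (hderiv t).clm_apply (hint.integral_hasStrictDerivAt 0 t).hasDerivAt using 1
  have hinv : S t (S (-t) (g t)) = g t :=
    congrArg (fun M : E →L[ℝ] E => M (g t)) (exp_smul_mul_exp_neg_smul L t)
  simp [hinv]

-- The primitive `U` of the merely integrable `f` is split off: `ξ = x - U` solves
-- `ξ' = L ξ + L U`, whose forcing term is continuous.
theorem exists_isPrimitive_clm_add [CompleteSpace E] (L : E →L[ℝ] E) {f : ℝ → E}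
    (hf : ∀ t, 0 ≤ t → IntervalIntegrable f volume 0 t) :
    ∃ x : ℝ → E, x 0 = 0 ∧ IsPrimitive (fun t => L (x t) + f t) x := by
  set U : ℝ → E := fun t => ∫ s in (0 : ℝ)..t, f s with hU
  have hUf : IsPrimitive f U := isPrimitive_intervalIntegral hf
  have hg : Continuous fun t => L (U (max t 0)) := L.continuous.comp
    (hUf.continuousOn.comp_continuous (by fun_prop) fun t => le_max_right t 0)
  obtain ⟨ξ, hξ0, hξ⟩ := exists_hasDerivAt_clm_add L hg
  have hξc : Continuous ξ := continuous_iff_continuousAt.2 fun t => (hξ t).continuousAt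
  have hξp : IsPrimitive (fun t => L (ξ t) + L (U (max t 0))) ξ :=
    .of_hasDerivAt ((L.continuous.comp hξc).add hg) hξ
  refine ⟨fun t => ξ t + U t, by simp [hξ0, hU], (hξp.add hUf).congr fun t ht => ?_⟩
  simp only [max_eq_left ht.le, map_add]

end Existence

section Trajectories

variable {A : Matrix ι ι ℝ} {B : Matrix ι κ ℝ} {u : ℝ → κ → ℝ} {x₀ y₀ : ι → ℝ}
  {x y : ℝ → ι → ℝ}

theorem exists_isTrajectory_zero (A : Matrix ι ι ℝ) (B : Matrix ι κ ℝ)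
    (hu : ∀ t, 0 ≤ t → IntervalIntegrable u volume 0 t) : ∃ x, IsTrajectory A B u 0 x := by
  have hBu (t : ℝ) (ht : 0 ≤ t) : IntervalIntegrable (fun s => B *ᵥ u s) volume 0 t :=
    ((isPrimitive_intervalIntegral hu).mulVec B).intervalIntegrable t ht
  obtain ⟨x, hx0, hx⟩ := exists_isPrimitive_clm_add A.mulVecLin.toContinuousLinearMap hBu
  exact ⟨x, isTrajectory_iff.2 ⟨hx0, hx⟩⟩

theorem IsTrajectory.apply_zero (h : IsTrajectory A B u x₀ x) : x 0 = x₀ :=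
  (isTrajectory_iff.1 h).1

theorem IsTrajectory.isPrimitive (h : IsTrajectory A B u x₀ x) :
    IsPrimitive (fun t => A *ᵥ x t + B *ᵥ u t) x :=
  (isTrajectory_iff.1 h).2

theorem IsTrajectory.map {A' : Matrix ρ ρ ℝ} {B' : Matrix ρ κ ℝ} (h : IsTrajectory A B u x₀ x)
    (M : Matrix ρ ι ℝ) (hA : M * A = A' * M) (hB : M * B = B') :
    IsTrajectory A' B' u (M *ᵥ x₀) (fun t => M *ᵥ x t) := by
  refine isTrajectory_iff.2 ⟨by rw [h.apply_zero], (h.isPrimitive.mulVec M).congr fun t _ => ?_⟩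
  simp only [mulVec_add, mulVec_mulVec, hA, hB]

theorem IsTrajectory.sub (hx : IsTrajectory A B u x₀ x) (hy : IsTrajectory A B u y₀ y) :
    IsTrajectory A (0 : Matrix ι κ ℝ) u (x₀ - y₀) (fun t => x t - y t) := by
  refine isTrajectory_iff.2 ⟨by rw [hx.apply_zero, hy.apply_zero],
    (hx.isPrimitive.sub hy.isPrimitive).congr fun t _ => ?_⟩
  rw [mulVec_sub, zero_mulVec, add_zero, add_sub_add_right_eq_sub]

variable {A' : Matrix ρ ρ ℝ} {B' : Matrix ρ κ ℝ} {x₀' : ρ → ℝ}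
  {z : ℝ → ι ⊕ ρ → ℝ}

theorem IsTrajectory.inl (h : IsTrajectory (fromBlocks A 0 0 A') (fromRows B B')
    u (Sum.elim x₀ x₀') z) : IsTrajectory A B u x₀ fun t => z t ∘ Sum.inl := by
  classical
  simpa [fromCols_mulVec] using h.map (fromCols (1 : Matrix ι ι ℝ) (0 : Matrix ι ρ ℝ))
    (by simp [fromCols_mul_fromBlocks, mul_fromCols]) (by simp [fromCols_mul_fromRows])

theorem IsTrajectory.inr (h : IsTrajectory (fromBlocks A 0 0 A') (fromRows B B')
    u (Sum.elim x₀ x₀') z) : IsTrajectory A' B' u x₀' fun t => z t ∘ Sum.inr := by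
  classical
  simpa [fromCols_mulVec] using h.map (fromCols (0 : Matrix ρ ι ℝ) (1 : Matrix ρ ρ ℝ))
    (by simp [fromCols_mul_fromBlocks, mul_fromCols]) (by simp [fromCols_mul_fromRows])

end Trajectories

section Gain

/-- The systems `(A, B, C)` and `(A', B', C')`, started at rest and driven by the same input
`u ∈ L₂([0, ∞), ℝ^κ)`, have outputs at `L₂`-distance at most `γ ‖u‖`. -/
def HasErrorGain (A : Matrix ι ι ℝ) (B : Matrix ι κ ℝ) (C : Matrix η ι ℝ)
    (A' : Matrix ρ ρ ℝ) (B' : Matrix ρ κ ℝ) (C' : Matrix η ρ ℝ) (γ : ℝ) : Prop :=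
  ∀ ⦃u : ℝ → κ → ℝ⦄ ⦃x : ℝ → ι → ℝ⦄ ⦃x' : ℝ → ρ → ℝ⦄, MemL2 u → IsTrajectory A B u 0 x →
    IsTrajectory A' B' u 0 x' → NormL2LE (fun t => C *ᵥ x t - C' *ᵥ x' t) (γ * normL2 u)

namespace HasErrorGain

variable {A : Matrix ι ι ℝ} {B : Matrix ι κ ℝ} {C : Matrix η ι ℝ}
  {A₁ : Matrix ρ ρ ℝ} {B₁ : Matrix ρ κ ℝ} {C₁ : Matrix η ρ ℝ}
  {A₂ : Matrix τ τ ℝ} {B₂ : Matrix τ κ ℝ} {C₂ : Matrix η τ ℝ}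

theorem mono {γ γ' : ℝ} (h : HasErrorGain A B C A₁ B₁ C₁ γ) (hγ : γ ≤ γ') :
    HasErrorGain A B C A₁ B₁ C₁ γ' := fun _ _ _ hu hx hx' =>
  (h hu hx hx').mono (mul_le_mul_of_nonneg_right hγ (Real.sqrt_nonneg _))

theorem trans {γ₁ γ₂ : ℝ} (h₁ : HasErrorGain A B C A₁ B₁ C₁ γ₁)
    (h₂ : HasErrorGain A₁ B₁ C₁ A₂ B₂ C₂ γ₂) : HasErrorGain A B C A₂ B₂ C₂ (γ₁ + γ₂) := by
  intro u x x' hu hx hx'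
  obtain ⟨x₁, hx₁⟩ := exists_isTrajectory_zero A₁ B₁ hu.intervalIntegrable
  rw [add_mul]
  exact ((h₁ hu hx hx₁).add (h₂ hu hx₁ hx')).congr fun t _ => (sub_add_sub_cancel _ _ _).symm

end HasErrorGain

end Gain

section Gramians

variable {R : Type*} [Ring R] [StarRing R]

/-- The Lyapunov equation `A P + P Aᴴ + B Bᴴ = 0` of the controllability Gramian `P` of `(A, B)`.
The observability Gramian `Q` of `(A, C)` satisfies `IsGramian Aᴴ Cᴴ Q`, so that statements about
the two Gramians are instances of each other. -/
def IsGramian (A : Matrix ι ι R) (B : Matrix ι κ R) (P : Matrix ι ι R) : Prop :=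
  A * P + P * Aᴴ + B * Bᴴ = 0

/-- A Petrov–Galerkin projection `V Wᴴ` that balances `P` and `Q`: the Gramians of the projected
system `(Wᴴ A V, Wᴴ B, C V)` are both equal to `S`. -/
structure IsBalancingPair [DecidableEq ρ] (P Q : Matrix ι ι R) (V W : Matrix ι ρ R)
    (S : Matrix ρ ρ R) : Prop where
  mul_left : P * W = V * S
  mul_right : Q * V = W * S
  conjTranspose_mul : Wᴴ * V = 1

variable {A : Matrix ι ι R} {B : Matrix ι κ R} {C : Matrix η ι R} {P Q : Matrix ι ι R}
  {V W : Matrix ι ρ R} {S : Matrix ρ ρ R}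

theorem IsGramian.reduce (h : IsGramian A B P) (hP : P.IsHermitian) (hS : S.IsHermitian)
    (hPW : P * W = V * S) : IsGramian (Wᴴ * A * V) (Wᴴ * B) S := by
  have hWP : Wᴴ * P = S * Vᴴ := by
    simpa only [conjTranspose_mul, hP.eq, hS.eq] using congrArg conjTranspose hPW
  calc Wᴴ * A * V * S + S * (Wᴴ * A * V)ᴴ + Wᴴ * B * (Wᴴ * B)ᴴ
      = Wᴴ * A * (V * S) + S * Vᴴ * Aᴴ * W + Wᴴ * B * Bᴴ * W := by
        simp only [conjTranspose_mul, conjTranspose_conjTranspose, Matrix.mul_assoc]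
    _ = Wᴴ * (A * P + P * Aᴴ + B * Bᴴ) * W := by
        rw [← hPW, ← hWP]
        simp only [Matrix.mul_add, Matrix.add_mul, Matrix.mul_assoc]
    _ = 0 := by rw [h, Matrix.mul_zero, Matrix.zero_mul]

theorem IsGramian.map (h : IsGramian A B P) {R' : Type*} [Ring R'] [StarRing R'] (φ : R →+* R')
    (hφ : Function.Semiconj φ star star) : IsGramian (A.map φ) (B.map φ) (P.map φ) := by
  rw [IsGramian]
  simpa only [Matrix.map_add _ (map_add φ), Matrix.map_mul, Matrix.map_zero _ (map_zero φ),
    conjTranspose_map φ hφ] using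
    congrArg (Matrix.map · φ) h

theorem IsGramian.mul_eq_zero [PartialOrder R] [StarOrderedRing R] [NoZeroDivisors R]
    (h : IsGramian A B P) (hP : P.IsHermitian) {ν : Type*} {K : Matrix ν ι R} (hK : K * P = 0) :
    K * B = 0 ∧ K * A * P = 0 := by
  have hPK : P * Kᴴ = 0 := by
    simpa only [conjTranspose_mul, hP.eq, conjTranspose_zero] using congrArg conjTranspose hK
  have hKh : K * A * P + K * P * Aᴴ + K * B * Bᴴ = 0 := by
    simpa only [Matrix.mul_add, Matrix.mul_assoc, Matrix.mul_zero] using congrArg (K * ·) h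
  have hKB : K * B * (K * B)ᴴ = 0 := by
    have := congrArg (· * Kᴴ) hKh
    simpa only [hK, Matrix.zero_mul, add_zero, Matrix.add_mul, Matrix.mul_assoc, hPK,
      Matrix.mul_zero, zero_add, conjTranspose_mul] using this
  have hKB : K * B = 0 := self_mul_conjTranspose_eq_zero.1 hKB
  refine ⟨hKB, ?_⟩
  simpa only [hK, hKB, Matrix.zero_mul, add_zero] using hKh

namespace IsBalancingPair

variable [DecidableEq ρ]

theorem symm (h : IsBalancingPair P Q V W S) : IsBalancingPair Q P W V S where
  mul_left := h.mul_right
  mul_right := h.mul_left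
  conjTranspose_mul := by
    simpa only [Matrix.conjTranspose_mul, conjTranspose_conjTranspose, conjTranspose_one] using
      congrArg conjTranspose h.conjTranspose_mul

theorem map (h : IsBalancingPair P Q V W S) {R' : Type*} [Ring R'] [StarRing R'] (φ : R →+* R')
    (hφ : Function.Semiconj φ star star) :
    IsBalancingPair (P.map φ) (Q.map φ) (V.map φ) (W.map φ) (S.map φ) where
  mul_left := by rw [← Matrix.map_mul, h.mul_left, Matrix.map_mul]
  mul_right := by rw [← Matrix.map_mul, h.mul_right, Matrix.map_mul]
  conjTranspose_mul := by
    rw [← conjTranspose_map φ hφ, ← Matrix.map_mul, h.conjTranspose_mul,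
      Matrix.map_one _ (map_zero φ) (map_one φ)]

theorem isGramian (h : IsBalancingPair P Q V W S) (hP : P.IsHermitian) (hS : S.IsHermitian)
    (hAB : IsGramian A B P) : IsGramian (Wᴴ * A * V) (Wᴴ * B) S :=
  hAB.reduce hP hS h.mul_left

theorem isGramian_conjTranspose (h : IsBalancingPair P Q V W S) (hQ : Q.IsHermitian)
    (hS : S.IsHermitian) (hAC : IsGramian Aᴴ Cᴴ Q) :
    IsGramian (Wᴴ * A * V)ᴴ (C * V)ᴴ S := by
  simpa only [Matrix.conjTranspose_mul, conjTranspose_conjTranspose, Matrix.mul_assoc] using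
    h.symm.isGramian hQ hS hAC

end IsBalancingPair

end Gramians

theorem IsGramian.inv {R : Type*} [CommRing R] [StarRing R] [DecidableEq ι] {A S : Matrix ι ι R}
    {B : Matrix ι κ R} (h : IsGramian A B S) (hS : S.IsHermitian) (hdet : IsUnit S.det) :
    IsGramian Aᴴ (S⁻¹ * B) S⁻¹ := by
  calc Aᴴ * S⁻¹ + S⁻¹ * Aᴴᴴ + S⁻¹ * B * (S⁻¹ * B)ᴴ
      = S⁻¹ * (A * S + S * Aᴴ + B * Bᴴ) * S⁻¹ := by
        simp only [Matrix.mul_add, Matrix.add_mul, conjTranspose_mul, conjTranspose_conjTranspose,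
          hS.inv.eq, Matrix.mul_assoc, Matrix.mul_nonsing_inv _ hdet, Matrix.mul_one]
        rw [Matrix.nonsing_inv_mul_cancel_left _ _ hdet, add_comm (Aᴴ * S⁻¹)]
    _ = 0 := by rw [h, Matrix.mul_zero, Matrix.zero_mul]

theorem IsGramian.star_dotProduct_add {R : Type*} [CommRing R] [StarRing R] {A Q : Matrix ι ι R}
    {B : Matrix ι κ R} (h : IsGramian Aᴴ B Q) (z : ι → R) :
    star (A *ᵥ z) ⬝ᵥ Q *ᵥ z + star z ⬝ᵥ Q *ᵥ A *ᵥ z + star (Bᴴ *ᵥ z) ⬝ᵥ Bᴴ *ᵥ z = 0 := by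
  have hz : star z ⬝ᵥ (Aᴴ * Q + Q * Aᴴᴴ + B * Bᴴ) *ᵥ z = 0 := by
    rw [show Aᴴ * Q + Q * Aᴴᴴ + B * Bᴴ = 0 from h, zero_mulVec, dotProduct_zero]
  simpa only [star_mulVec, conjTranspose_conjTranspose, ← dotProduct_mulVec, mulVec_mulVec,
    add_mulVec, dotProduct_add] using hz

section TruncationGain

variable {A : Matrix ι ι ℝ} {B : Matrix ι κ ℝ} {C : Matrix η ι ℝ}

theorem dotProduct_mulVec_comm_of_isHermitian {M : Matrix ι ι ℝ} (hM : M.IsHermitian)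
    (v w : ι → ℝ) : v ⬝ᵥ M *ᵥ w = M *ᵥ v ⬝ᵥ w := by
  rw [dotProduct_mulVec, ← mulVec_transpose, show Mᵀ = M from hM]

theorem IsGramian.two_mul_dotProduct {Q : Matrix ι ι ℝ} (h : IsGramian Aᴴ B Q)
    (hQ : Q.IsHermitian) (z : ι → ℝ) :
    2 * (A *ᵥ z ⬝ᵥ Q *ᵥ z) = -(Bᴴ *ᵥ z ⬝ᵥ Bᴴ *ᵥ z) := by
  have hz := h.star_dotProduct_add z
  simp only [star_trivial] at hz
  rw [dotProduct_mulVec_comm_of_isHermitian hQ z, dotProduct_comm (Q *ᵥ z)] at hz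
  linarith

section Projection

variable {V W : Matrix ι ρ ℝ} [DecidableEq ι] {u : ℝ → κ → ℝ} {x : ℝ → ι → ℝ} {ξ : ℝ → ρ → ℝ}

theorem IsTrajectory.isPrimitive_sub_projection (hx : IsTrajectory A B u 0 x)
    (hξ : IsTrajectory (Wᴴ * A * V) (Wᴴ * B) u 0 ξ) :
    IsPrimitive (fun t => A *ᵥ (x t - V *ᵥ ξ t) + (1 - V * Wᴴ) *ᵥ (A *ᵥ V *ᵥ ξ t + B *ᵥ u t))
      (fun t => x t - V *ᵥ ξ t) :=
  (hx.isPrimitive.sub (hξ.isPrimitive.mulVec V)).congr fun t _ => by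
    simp only [mulVec_sub, mulVec_add, mulVec_mulVec, Matrix.mul_assoc, Matrix.sub_mul,
      Matrix.one_mul, sub_mulVec]
    abel

theorem IsTrajectory.isPrimitive_add_projection (hx : IsTrajectory A B u 0 x)
    (hξ : IsTrajectory (Wᴴ * A * V) (Wᴴ * B) u 0 ξ) :
    IsPrimitive (fun t => A *ᵥ (x t + V *ᵥ ξ t) + (2 : ℝ) • B *ᵥ u t -
      (1 - V * Wᴴ) *ᵥ (A *ᵥ V *ᵥ ξ t + B *ᵥ u t)) (fun t => x t + V *ᵥ ξ t) :=
  (hx.isPrimitive.add (hξ.isPrimitive.mulVec V)).congr fun t _ => by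
    simp only [mulVec_add, mulVec_mulVec, Matrix.mul_assoc, Matrix.sub_mul, Matrix.one_mul,
      sub_mulVec, two_smul]
    abel

end Projection

theorem IsBalancingPair.hasErrorGain_zero [DecidableEq ι] [DecidableEq ρ] {P Q : Matrix ι ι ℝ}
    {V W : Matrix ι ρ ℝ} {S : Matrix ρ ρ ℝ} (h : IsBalancingPair P Q V W S)
    (hP : P.IsHermitian) (hQ : Q.PosSemidef) (hS : IsUnit S.det) (hc : IsGramian A B P)
    (ho : IsGramian Aᴴ Cᴴ Q) (hdefect : Q * (1 - V * Wᴴ) * P = 0) :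
    HasErrorGain A B C (Wᴴ * A * V) (Wᴴ * B) (C * V) 0 := by
  intro u x ξ hu hx hξ
  obtain ⟨hKB, hKAP⟩ := hc.mul_eq_zero hP hdefect
  have hKAV : Q * (1 - V * Wᴴ) * A * V = 0 := by
    have hKAVS : Q * (1 - V * Wᴴ) * A * V * S = 0 := by
      rw [Matrix.mul_assoc _ V S, ← h.mul_left, ← Matrix.mul_assoc, hKAP, Matrix.zero_mul]
    have := congrArg (· * S⁻¹) hKAVS
    simpa only [Matrix.mul_nonsing_inv_cancel_right _ _ hS, Matrix.zero_mul] using this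
  set z : ℝ → ι → ℝ := fun t => x t - V *ᵥ ξ t with hz
  set k : ℝ → ι → ℝ := fun t => (1 - V * Wᴴ) *ᵥ (A *ᵥ V *ᵥ ξ t + B *ᵥ u t) with hk
  have hQk : ∀ t, Q *ᵥ k t = 0 := fun t => by
    simp only [hk, mulVec_add, mulVec_mulVec, ← Matrix.mul_assoc, hKAV, hKB, zero_mulVec, add_zero]
  have hzp : IsPrimitive (fun t => A *ᵥ z t + k t) z := hx.isPrimitive_sub_projection hξ
  have hz0 : z 0 = 0 := by simp [hz, hx.apply_zero, hξ.apply_zero]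
  refine (normL2LE_of_dissipation hu (e := fun t => C *ᵥ z t) ?_ le_rfl
    (hzp.quadraticForm hQ.isHermitian) (by simp [hz0])
    (fun t _ => hQ.dotProduct_mulVec_nonneg (z t)) fun t _ => ?_).congr fun t _ => ?_
  · exact (hzp.mulVec C).continuousOn
  · have hrate := ho.two_mul_dotProduct hQ.isHermitian (z t)
    have hkz : k t ⬝ᵥ Q *ᵥ z t = 0 := by
      rw [dotProduct_mulVec_comm_of_isHermitian hQ.isHermitian, hQk, zero_dotProduct]
    rw [conjTranspose_conjTranspose] at hrate
    rw [add_dotProduct, hkz]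
    linarith
  · simp only [hz, mulVec_sub, mulVec_mulVec]

-- Completing the square: `4 u ⬝ g ≤ 4 |u|² + |g|²`.
theorem four_mul_dotProduct_le (u g : κ → ℝ) : 4 * (u ⬝ᵥ g) ≤ 4 * (u ⬝ᵥ u) + g ⬝ᵥ g := by
  have hsq : 0 ≤ ((2 : ℝ) • u - g) ⬝ᵥ ((2 : ℝ) • u - g) := dotProduct_star_self_nonneg _
  simp only [sub_dotProduct, dotProduct_sub, smul_dotProduct, dotProduct_smul, smul_eq_mul,
    dotProduct_comm g u] at hsq
  linarith

-- The perturbation `h` drops out: by `S h = s h` it contributes `2 s h ⬝ z` to the first term and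
-- `-2 s h ⬝ w` to the second.
theorem IsGramian.dissipation_le [DecidableEq ι] {S : Matrix ι ι ℝ} (hS : S.PosDef)
    (hc : IsGramian A B S) (ho : IsGramian Aᴴ Cᴴ S) {s : ℝ} {h z w : ι → ℝ} (u : κ → ℝ)
    (hs : s ≠ 0) (hSh : S *ᵥ h = s • h) (hzw : h ⬝ᵥ z = h ⬝ᵥ w) :
    2 * ((A *ᵥ z + h) ⬝ᵥ S *ᵥ z) + s ^ 2 * (2 * ((A *ᵥ w + (2 : ℝ) • B *ᵥ u - h) ⬝ᵥ S⁻¹ *ᵥ w)) ≤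
      (2 * s) ^ 2 * (u ⬝ᵥ u) - C *ᵥ z ⬝ᵥ C *ᵥ z := by
  have hdet : IsUnit S.det := (Matrix.isUnit_iff_isUnit_det S).1 hS.isUnit
  have hSinv : S⁻¹ *ᵥ h = s⁻¹ • h := by
    have : h = s⁻¹ • S *ᵥ h := by rw [hSh, inv_smul_smul₀ hs]
    conv_lhs => rw [this, mulVec_smul, mulVec_mulVec, Matrix.nonsing_inv_mul _ hdet, one_mulVec]
  have hz_rate := ho.two_mul_dotProduct hS.isHermitian z
  have hw_rate := (hc.inv hS.isHermitian hdet).two_mul_dotProduct hS.isHermitian.inv w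
  rw [conjTranspose_conjTranspose] at hz_rate
  rw [conjTranspose_mul, hS.isHermitian.inv.eq, ← mulVec_mulVec] at hw_rate
  have hhz : h ⬝ᵥ S *ᵥ z = s * (h ⬝ᵥ z) := by
    rw [dotProduct_mulVec_comm_of_isHermitian hS.isHermitian, hSh, smul_dotProduct, smul_eq_mul]
  have hhw : h ⬝ᵥ S⁻¹ *ᵥ w = s⁻¹ * (h ⬝ᵥ w) := by
    rw [dotProduct_mulVec_comm_of_isHermitian hS.isHermitian.inv, hSinv, smul_dotProduct,
      smul_eq_mul]
  have hBu : B *ᵥ u ⬝ᵥ S⁻¹ *ᵥ w = u ⬝ᵥ Bᴴ *ᵥ S⁻¹ *ᵥ w := by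
    rw [dotProduct_mulVec u, ← mulVec_transpose, show Bᴴᵀ = B from rfl]
  have hsq := mul_le_mul_of_nonneg_left (four_mul_dotProduct_le u (Bᴴ *ᵥ S⁻¹ *ᵥ w)) (sq_nonneg s)
  simp only [add_dotProduct, sub_dotProduct, smul_dotProduct, smul_eq_mul, hhz, hhw, hBu, hzw]
  have hcancel : s ^ 2 * (s⁻¹ * (h ⬝ᵥ w)) = s * (h ⬝ᵥ w) := by field_simp
  linear_combination hsq + hz_rate + s ^ 2 * hw_rate - 2 * hcancel

theorem hasErrorGain_truncation [DecidableEq ι] [DecidableEq ρ] {S : Matrix ι ι ℝ}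
    (hS : S.PosDef) (hc : IsGramian A B S) (ho : IsGramian Aᴴ Cᴴ S) {E : Matrix ι ρ ℝ}
    (hE : Eᴴ * E = 1) {s : ℝ} (hs : 0 < s) (hSE : S * (1 - E * Eᴴ) = s • (1 - E * Eᴴ)) :
    HasErrorGain A B C (Eᴴ * A * E) (Eᴴ * B) (C * E) (2 * s) := by
  intro u x ξ hu hx hξ
  set z : ℝ → ι → ℝ := fun t => x t - E *ᵥ ξ t with hz
  set w : ℝ → ι → ℝ := fun t => x t + E *ᵥ ξ t with hw
  set h : ℝ → ι → ℝ := fun t => (1 - E * Eᴴ) *ᵥ (A *ᵥ E *ᵥ ξ t + B *ᵥ u t) with hh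
  have hzp : IsPrimitive (fun t => A *ᵥ z t + h t) z := hx.isPrimitive_sub_projection hξ
  have hwp : IsPrimitive (fun t => A *ᵥ w t + (2 : ℝ) • B *ᵥ u t - h t) w :=
    hx.isPrimitive_add_projection hξ
  have hSh : ∀ t, S *ᵥ h t = s • h t := fun t => by
    simp only [hh, mulVec_mulVec, hSE, smul_mulVec]
  have hzw : ∀ t, h t ⬝ᵥ z t = h t ⬝ᵥ w t := fun t => by
    have hEh : Eᴴ *ᵥ h t = 0 := by
      rw [hh, mulVec_mulVec, Matrix.mul_sub, Matrix.mul_one, ← Matrix.mul_assoc, hE,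
        Matrix.one_mul, sub_self, zero_mulVec]
    have hhE : h t ⬝ᵥ E *ᵥ ξ t = 0 := by
      rw [dotProduct_mulVec, ← mulVec_transpose, show Eᵀ *ᵥ h t = 0 from hEh, zero_dotProduct]
    rw [hz, hw, dotProduct_sub, dotProduct_add, hhE, sub_zero, add_zero]
  have hz0 : z 0 = 0 := by simp [hz, hx.apply_zero, hξ.apply_zero]
  have hw0 : w 0 = 0 := by simp [hw, hx.apply_zero, hξ.apply_zero]
  refine (normL2LE_of_dissipation hu (e := fun t => C *ᵥ z t) ?_ (by positivity)
    ((hzp.quadraticForm hS.isHermitian).add ((hwp.quadraticForm hS.isHermitian.inv).const_mul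
      (s ^ 2))) (by simp [hz0, hw0]) (fun t _ => ?_)
    fun t _ => IsGramian.dissipation_le hS hc ho (u t) hs.ne' (hSh t) (hzw t)).congr fun t _ => ?_
  · exact (hzp.mulVec C).continuousOn
  · exact add_nonneg (hS.posSemidef.dotProduct_mulVec_nonneg (z t))
      (mul_nonneg (sq_nonneg s) (hS.inv.posSemidef.dotProduct_mulVec_nonneg (w t)))
  · simp only [hz, mulVec_sub, mulVec_mulVec]

end TruncationGain

section Stability

open scoped ComplexOrder

theorem isAsymptoticallyStable_iff [DecidableEq ι] {A : Matrix ι ι ℝ} :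
    IsAsymptoticallyStable A ↔ ∀ (μ : ℂ) (v : ι → ℂ), v ≠ 0 →
      A.map (algebraMap ℝ ℂ) *ᵥ v = μ • v → μ.re < 0 := by
  have hspec : ∀ μ : ℂ, μ ∈ spectrum ℂ (A.map (algebraMap ℝ ℂ)) ↔
      ∃ v : ι → ℂ, A.map (algebraMap ℝ ℂ) *ᵥ v = μ • v ∧ v ≠ 0 := fun μ => by
    rw [← Matrix.spectrum_toLin', ← Module.End.hasEigenvalue_iff_mem_spectrum]
    refine ⟨fun h => h.exists_hasEigenvector.imp fun v hv => ?_, fun ⟨v, hv⟩ => ?_⟩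
    · exact Module.End.hasEigenvector_iff.1 hv |>.imp_left Module.End.mem_eigenspace_iff.1
    · exact Module.End.hasEigenvalue_of_hasEigenvector
        (Module.End.hasEigenvector_iff.2 ⟨Module.End.mem_eigenspace_iff.2 hv.1, hv.2⟩)
  exact ⟨fun h μ v hv hAv => h μ ((hspec μ).2 ⟨v, hAv, hv⟩),
    fun h μ hμ => let ⟨v, hAv, hv⟩ := (hspec μ).1 hμ; h μ v hv hAv⟩

theorem isAsymptoticallyStable_fromBlocks_diagonal [DecidableEq ι] [DecidableEq ρ]
    {A : Matrix ι ι ℝ} {D : Matrix ρ ρ ℝ} (hA : IsAsymptoticallyStable A)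
    (hD : IsAsymptoticallyStable D) : IsAsymptoticallyStable (fromBlocks A 0 0 D) := by
  rw [isAsymptoticallyStable_iff] at hA hD ⊢
  intro μ v hv hμ
  have hblocks : Sum.elim (A.map (algebraMap ℝ ℂ) *ᵥ (v ∘ Sum.inl))
      (D.map (algebraMap ℝ ℂ) *ᵥ (v ∘ Sum.inr)) = μ • v := by
    simpa [fromBlocks_map, fromBlocks_mulVec] using hμ
  by_cases hinl : v ∘ Sum.inl = 0
  · refine hD μ (v ∘ Sum.inr) (fun hinr => hv ?_) (funext fun j => congrFun hblocks (Sum.inr j))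
    funext i
    exact i.casesOn (congrFun hinl) (congrFun hinr)
  · exact hA μ _ hinl (funext fun i => congrFun hblocks (Sum.inl i))

section Complex

variable {A P Q : Matrix ι ι ℂ} {B : Matrix ι κ ℂ} {C : Matrix η ι ℂ} {S : Matrix ι ι ℂ}

theorem IsGramian.of_eigenvector (h : IsGramian Aᴴ B S) (hS : S.PosDef) {μ : ℂ} {w : ι → ℂ}
    (hw : w ≠ 0) (hAw : A *ᵥ w = μ • w) (hμ : 0 ≤ μ.re) :
    μ.re = 0 ∧ Bᴴ *ᵥ w = 0 ∧ Aᴴ *ᵥ S *ᵥ w = -μ • S *ᵥ w := by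
  have henergy : ((2 * μ.re : ℝ) : ℂ) * (star w ⬝ᵥ S *ᵥ w) +
      star (Bᴴ *ᵥ w) ⬝ᵥ Bᴴ *ᵥ w = 0 := by
    have := h.star_dotProduct_add w
    rw [hAw, star_smul, mulVec_smul, smul_dotProduct, dotProduct_smul, smul_eq_mul, smul_eq_mul,
      ← add_mul, add_comm (star μ), Complex.star_def, Complex.add_conj] at this
    exact_mod_cast this
  have hSw : 0 < star w ⬝ᵥ S *ᵥ w := hS.dotProduct_mulVec_pos hw
  have hμSw : 0 ≤ ((2 * μ.re : ℝ) : ℂ) * (star w ⬝ᵥ S *ᵥ w) :=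
    mul_nonneg (Complex.zero_le_real.2 (by linarith)) hSw.le
  obtain ⟨hμ0, hB0⟩ := (add_eq_zero_iff_of_nonneg hμSw (dotProduct_star_self_nonneg _)).1 henergy
  have hre : μ.re = 0 := by
    simpa [hSw.ne'] using hμ0
  have hBw : Bᴴ *ᵥ w = 0 := dotProduct_star_self_eq_zero.1 hB0
  refine ⟨hre, hBw, ?_⟩
  have hLyap : (Aᴴ * S + S * Aᴴᴴ + B * Bᴴ) *ᵥ w = 0 := by
    rw [show Aᴴ * S + S * Aᴴᴴ + B * Bᴴ = 0 from h, zero_mulVec]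
  rw [conjTranspose_conjTranspose, add_mulVec, add_mulVec, ← mulVec_mulVec, ← mulVec_mulVec,
    ← mulVec_mulVec, hAw, hBw, mulVec_zero, add_zero, mulVec_smul] at hLyap
  rw [neg_smul]
  exact eq_neg_of_add_eq_zero_left hLyap

theorem IsGramian.balanced_of_eigenvector (hS : S.PosDef) (hc : IsGramian A B S)
    (ho : IsGramian Aᴴ Cᴴ S) {μ : ℂ} {w : ι → ℂ} (hw : w ≠ 0) (hAw : A *ᵥ w = μ • w)
    (hμ : 0 ≤ μ.re) : C *ᵥ w = 0 ∧ Bᴴ *ᵥ S *ᵥ w = 0 ∧ A *ᵥ S *ᵥ S *ᵥ w = μ • S *ᵥ S *ᵥ w := by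
  obtain ⟨hre, hCw, hASw⟩ := ho.of_eigenvector hS hw hAw hμ
  have hSw : S *ᵥ w ≠ 0 := fun h0 => by
    simpa [h0] using hS.dotProduct_mulVec_pos hw
  rw [← conjTranspose_conjTranspose A] at hc
  obtain ⟨-, hBSw, hASSw⟩ := hc.of_eigenvector hS hSw hASw (by simp [hre])
  rw [conjTranspose_conjTranspose] at hCw
  rw [conjTranspose_conjTranspose, neg_neg] at hASSw
  exact ⟨hCw, hBSw, hASSw⟩

theorem exists_common_eigenvector {K : Type*} [Field K] [IsAlgClosed K] {M N : Matrix ι ι K}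
    {μ : K} {v : ι → K} (hv : v ≠ 0) (hMv : M *ᵥ v = μ • v)
    (hinv : ∀ w, M *ᵥ w = μ • w → M *ᵥ N *ᵥ w = μ • N *ᵥ w) :
    ∃ w ≠ 0, M *ᵥ w = μ • w ∧ ∃ ν : K, N *ᵥ w = ν • w := by
  let F : Submodule K (ι → K) := Module.End.eigenspace M.mulVecLin μ
  have hF : ∀ w, w ∈ F ↔ M *ᵥ w = μ • w := fun w => Module.End.mem_eigenspace_iff
  have hNF : ∀ w ∈ F, N.mulVecLin w ∈ F := fun w hw => (hF _).2 (hinv w ((hF w).1 hw))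
  have : Nontrivial F := ⟨⟨⟨v, (hF v).2 hMv⟩, 0, fun h => hv (congrArg Subtype.val h)⟩⟩
  obtain ⟨ν, hν⟩ := Module.End.exists_eigenvalue (N.mulVecLin.restrict hNF)
  obtain ⟨⟨w, hw⟩, hNw⟩ := hν.exists_hasEigenvector
  exact ⟨w, fun h => hNw.2 (Subtype.ext h), (hF w).1 hw, ν, congrArg Subtype.val hNw.apply_eq_smul⟩

theorem IsGramian.mulVec_comm {R : Type*} [CommRing R] [StarRing R] {A P Q : Matrix ι ι R}
    {B : Matrix ι κ R} {C : Matrix η ι R} (hc : IsGramian A B P) (ho : IsGramian Aᴴ Cᴴ Q)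
    {v : ι → R} (hCv : C *ᵥ v = 0) (hBv : Bᴴ *ᵥ Q *ᵥ v = 0) :
    P *ᵥ Q *ᵥ A *ᵥ v = A *ᵥ P *ᵥ Q *ᵥ v := by
  have hQAv : Aᴴ *ᵥ Q *ᵥ v + Q *ᵥ A *ᵥ v = 0 := by
    simpa only [add_mulVec, ← mulVec_mulVec, zero_mulVec, conjTranspose_conjTranspose, hCv,
      mulVec_zero, add_zero] using congrArg (· *ᵥ v) ho
  have hAPQv : A *ᵥ P *ᵥ Q *ᵥ v + P *ᵥ Aᴴ *ᵥ Q *ᵥ v = 0 := by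
    simpa only [add_mulVec, ← mulVec_mulVec, zero_mulVec, hBv, mulVec_zero, add_zero] using
      congrArg (· *ᵥ Q *ᵥ v) hc
  rw [eq_neg_of_add_eq_zero_right hQAv, mulVec_neg]
  exact (eq_neg_of_add_eq_zero_left hAPQv).symm

-- The eigenspace of the reduced matrix is invariant under `S ^ 2`, so it contains an eigenvector
-- `w` of `S ^ 2`. The defect `b` below is killed by `Wᴴ` and is an eigenvector of `P * Q` to an
-- eigenvalue of `S ^ 2`, hence zero, that is, `A *ᵥ V *ᵥ w = μ • V *ᵥ w`.
theorem IsBalancingPair.exists_eigenvector [DecidableEq ρ] {V W : Matrix ι ρ ℂ} {S : Matrix ρ ρ ℂ}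
    (h : IsBalancingPair P Q V W S) (hP : P.IsHermitian) (hQ : Q.IsHermitian) (hS : S.PosDef)
    (hc : IsGramian A B P) (ho : IsGramian Aᴴ Cᴴ Q)
    (hsep : ∀ (ν : ℂ) (w : ρ → ℂ) (b : ι → ℂ), w ≠ 0 → S *ᵥ S *ᵥ w = ν • w →
      P *ᵥ Q *ᵥ b = ν • b → Wᴴ *ᵥ b = 0 → b = 0)
    {μ : ℂ} {v : ρ → ℂ} (hv : v ≠ 0) (hAv : (Wᴴ * A * V) *ᵥ v = μ • v) (hμ : 0 ≤ μ.re) :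
    ∃ w ≠ 0, A *ᵥ w = μ • w := by
  have hbal := fun (w : ρ → ℂ) hw => IsGramian.balanced_of_eigenvector (w := w) (μ := μ) hS
    (h.isGramian hP hS.1 hc) (h.isGramian_conjTranspose hQ hS.1 ho) hw
  obtain ⟨w, hw, hAw, ν, hSw⟩ := exists_common_eigenvector (N := S * S) hv hAv fun w hAw => by
    rcases eq_or_ne w 0 with rfl | hw
    · simp only [mulVec_zero, smul_zero]
    · simpa only [mulVec_mulVec] using (hbal w hw hAw hμ).2.2
  rw [← mulVec_mulVec] at hSw
  obtain ⟨hCw, hBw, -⟩ := hbal w hw hAw hμ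
  have hQVw : Q *ᵥ V *ᵥ w = W *ᵥ S *ᵥ w := by
    rw [mulVec_mulVec w Q V, h.mul_right, ← mulVec_mulVec]
  have hPQV : P *ᵥ Q *ᵥ V *ᵥ w = ν • V *ᵥ w := by
    rw [hQVw, mulVec_mulVec _ P W, h.mul_left, ← mulVec_mulVec, hSw, mulVec_smul]
  have hPQA : P *ᵥ Q *ᵥ A *ᵥ V *ᵥ w = ν • A *ᵥ V *ᵥ w := by
    rw [hc.mulVec_comm ho (by rwa [mulVec_mulVec]), hPQV, mulVec_smul]
    rwa [hQVw, mulVec_mulVec, ← conjTranspose_conjTranspose W, ← Matrix.conjTranspose_mul]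
  have hb : A *ᵥ V *ᵥ w - μ • V *ᵥ w = 0 := by
    refine hsep ν w _ hw hSw ?_ ?_
    · rw [mulVec_sub, mulVec_sub, hPQA, mulVec_smul, mulVec_smul, hPQV, smul_comm, smul_sub]
    · rw [mulVec_sub, mulVec_smul, mulVec_mulVec _ Wᴴ V, h.conjTranspose_mul, one_mulVec, ← hAw,
        ← mulVec_mulVec, ← mulVec_mulVec, sub_self]
  refine ⟨V *ᵥ w, fun h0 => hw ?_, sub_eq_zero.1 hb⟩
  rw [← one_mulVec w, ← h.conjTranspose_mul, ← mulVec_mulVec, h0, mulVec_zero]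

end Complex

end Stability

section Factors

variable [DecidableEq τ] {d : τ → ℝ} {f : ρ → τ}

/-- The matrix `J Σ_f^{-1/2}`, where `J` selects the coordinates in the image of `f` and `Σ_f` holds
the corresponding singular values `d (f j)`: the projection matrices of the square-root method are
the products of the Gramian factors with it. -/
noncomputable def sqrtInvSelection (d : τ → ℝ) (f : ρ → τ) : Matrix τ ρ ℝ :=
  (diagonal fun i => (√(d i))⁻¹).submatrix id f

theorem sqrtInvSelection_comp {τ ν : Type*} [DecidableEq τ] [DecidableEq ρ] {d : τ → ℝ}
    {f : ρ → τ} (g : ν → ρ) :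
    sqrtInvSelection d (f ∘ g) = sqrtInvSelection d f * (1 : Matrix ρ ρ ℝ).submatrix id g :=
  (mul_submatrix_one (Equiv.refl ρ) g (sqrtInvSelection d f)).symm

theorem mul_sqrtInvSelection {ν : Type*} [DecidableEq ρ] (M : Matrix ν τ ℝ) :
    M * sqrtInvSelection d f = M.submatrix id f * diagonal fun j => (√(d (f j)))⁻¹ := by
  ext i j
  simp [sqrtInvSelection, mul_apply, diagonal_apply]

theorem diagonal_mul_sqrtInvSelection [DecidableEq ρ] :
    diagonal d * sqrtInvSelection d f = sqrtInvSelection d f * diagonal (d ∘ f) := by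
  ext i j
  rw [diagonal_mul, mul_diagonal, mul_comm]
  rcases eq_or_ne i (f j) with rfl | h
  · rfl
  · simp [sqrtInvSelection, h]

theorem conjTranspose_sqrtInvSelection_mul_mul {ρ : Type*} [DecidableEq ρ] {f : ρ → τ}
    (hf : f.Injective) (hpos : ∀ j, 0 < d (f j)) :
    (sqrtInvSelection d f)ᴴ * diagonal d * sqrtInvSelection d f = 1 := by
  ext j j'
  rw [mul_apply, Finset.sum_eq_single (f j)]
  · rcases eq_or_ne j j' with rfl | h
    · have hne : √(d (f j)) ≠ 0 := (Real.sqrt_pos.2 (hpos j)).ne'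
      simp only [sqrtInvSelection, conjTranspose_submatrix, mul_diagonal, submatrix_apply, id,
        conjTranspose_apply, diagonal_apply_eq, star_trivial, one_apply_eq]
      rw [← div_eq_inv_mul, Real.div_sqrt, mul_inv_cancel₀ hne]
    · simp [sqrtInvSelection, h, hf.ne h]
  · intro i _ hi
    simp [sqrtInvSelection, hi.symm]
  · simp

theorem diagonal_mul_sqrtInvSelection_mul (hf : f.Injective) (hpos : ∀ j, 0 < d (f j))
    (hd : ∀ i ∉ Set.range f, d i = 0) :
    diagonal d * sqrtInvSelection d f * (sqrtInvSelection d f)ᴴ * diagonal d = diagonal d := by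
  ext i i'
  by_cases hi : i ∈ Set.range f
  · obtain ⟨j, rfl⟩ := hi
    rw [mul_diagonal, mul_apply, Finset.sum_eq_single j]
    · rcases eq_or_ne (f j) i' with rfl | h
      · have hne : √(d (f j)) ≠ 0 := (Real.sqrt_pos.2 (hpos j)).ne'
        simp only [sqrtInvSelection, diagonal_mul, submatrix_apply, id, conjTranspose_apply,
          diagonal_apply_eq, star_trivial]
        rw [← div_eq_mul_inv (d _), Real.div_sqrt, mul_inv_cancel₀ hne, one_mul]
      · simp [sqrtInvSelection, h, h.symm]
    · intro j' _ h
      simp [sqrtInvSelection, hf.ne h.symm]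
    · simp
  · simp [Matrix.mul_assoc, diagonal_mul, diagonal_apply, hd i hi]

theorem isBalancingPair_mul_sqrtInvSelection [DecidableEq ρ] {R L : Matrix ι τ ℝ}
    (hLR : Lᴴ * R = diagonal d) (hf : f.Injective) (hpos : ∀ j, 0 < d (f j)) :
    IsBalancingPair (R * Rᴴ) (L * Lᴴ) (R * sqrtInvSelection d f) (L * sqrtInvSelection d f)
      (diagonal (d ∘ f)) := by
  have hRL : Rᴴ * L = diagonal d := by
    simpa using congrArg conjTranspose hLR
  constructor
  · rw [Matrix.mul_assoc R, ← Matrix.mul_assoc Rᴴ, hRL, diagonal_mul_sqrtInvSelection,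
      Matrix.mul_assoc]
  · rw [Matrix.mul_assoc L, ← Matrix.mul_assoc Lᴴ, hLR, diagonal_mul_sqrtInvSelection,
      Matrix.mul_assoc]
  · rw [conjTranspose_mul, Matrix.mul_assoc, ← Matrix.mul_assoc Lᴴ, hLR, ← Matrix.mul_assoc,
      conjTranspose_sqrtInvSelection_mul_mul hf hpos]

theorem mul_one_sub_mul_sqrtInvSelection_mul_eq_zero [DecidableEq ι] {R L : Matrix ι τ ℝ}
    (hLR : Lᴴ * R = diagonal d) (hf : f.Injective) (hpos : ∀ j, 0 < d (f j))
    (hd : ∀ i ∉ Set.range f, d i = 0) :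
    L * Lᴴ * (1 - R * sqrtInvSelection d f * (L * sqrtInvSelection d f)ᴴ) * (R * Rᴴ) = 0 := by
  have hselect := diagonal_mul_sqrtInvSelection_mul hf hpos hd
  calc L * Lᴴ * (1 - R * sqrtInvSelection d f * (L * sqrtInvSelection d f)ᴴ) * (R * Rᴴ)
      = L * (Lᴴ * R - Lᴴ * R * sqrtInvSelection d f * (sqrtInvSelection d f)ᴴ * (Lᴴ * R)) *
          Rᴴ := by
        simp only [Matrix.mul_sub, Matrix.sub_mul, Matrix.mul_one, conjTranspose_mul,
          Matrix.mul_assoc]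
    _ = 0 := by rw [hLR, hselect, sub_self, Matrix.mul_zero, Matrix.zero_mul]

section Gain

variable {A : Matrix ι ι ℝ} {B : Matrix ι κ ℝ} {C : Matrix η ι ℝ} {R L : Matrix ι τ ℝ}

theorem IsBalancingPair.hasErrorGain_option [DecidableEq ρ] {P Q : Matrix ι ι ℝ}
    {V W : Matrix ι (Option ρ) ℝ} {s : Option ρ → ℝ} (h : IsBalancingPair P Q V W (diagonal s))
    (hP : P.IsHermitian) (hQ : Q.IsHermitian) (hs : ∀ j, 0 < s j) (hc : IsGramian A B P)
    (ho : IsGramian Aᴴ Cᴴ Q) {E : Matrix (Option ρ) ρ ℝ}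
    (hE : E = (1 : Matrix (Option ρ) (Option ρ) ℝ).submatrix id some) :
    HasErrorGain (Wᴴ * A * V) (Wᴴ * B) (C * V) ((W * E)ᴴ * A * (V * E)) ((W * E)ᴴ * B) (C * (V * E))
      (2 * s none) := by
  have hS : (diagonal s).PosDef := PosDef.diagonal hs
  have hEE : Eᴴ * E = 1 := by
    ext i j
    simp [hE, mul_apply, one_apply]
  have hproj : 1 - E * Eᴴ = diagonal (Pi.single none 1) := by
    ext i j
    cases i <;> cases j <;> simp [hE, mul_apply, one_apply, diagonal_apply]
  have hgain := hasErrorGain_truncation hS (h.isGramian hP hS.1 hc)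
    (h.isGramian_conjTranspose hQ hS.1 ho) hEE (hs none) (by
      rw [hproj, diagonal_mul_diagonal, ← diagonal_smul]
      congr 1
      ext i
      cases i <;> simp)
  simpa only [Matrix.conjTranspose_mul, Matrix.mul_assoc] using hgain

theorem hasErrorGain_mul_sqrtInvSelection (hLR : Lᴴ * R = diagonal d) (hd : ∀ i, 0 ≤ d i)
    (hc : IsGramian A B (R * Rᴴ)) (ho : IsGramian Aᴴ Cᴴ (L * Lᴴ)) (t : Finset τ) :
    ∀ {ρ : Type*} [Fintype ρ] {f : ρ → τ}, f.Injective → (∀ j, 0 < d (f j)) →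
      (∀ i, d i ≠ 0 → i ∈ Set.range f ∨ i ∈ t) →
      HasErrorGain A B C ((L * sqrtInvSelection d f)ᴴ * A * (R * sqrtInvSelection d f))
        ((L * sqrtInvSelection d f)ᴴ * B) (C * (R * sqrtInvSelection d f)) (2 * ∑ i ∈ t, d i) := by
  classical
  have hP : (R * Rᴴ).PosSemidef := posSemidef_self_mul_conjTranspose R
  have hQ : (L * Lᴴ).PosSemidef := posSemidef_self_mul_conjTranspose L
  induction t using Finset.induction_on with
  | empty =>
    intro ρ _ f hf hpos ht
    have hdet : IsUnit (diagonal (d ∘ f)).det := (PosDef.diagonal hpos).det_pos.ne'.isUnit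
    rw [Finset.sum_empty, mul_zero]
    refine (isBalancingPair_mul_sqrtInvSelection hLR hf hpos).hasErrorGain_zero hP.1 hQ hdet hc ho
      (mul_one_sub_mul_sqrtInvSelection_mul_eq_zero hLR hf hpos fun i hi => ?_)
    by_contra hne
    simpa [hi] using ht i hne
  | insert a t ha ih =>
    intro ρ _ f hf hpos ht
    rw [Finset.sum_insert ha, mul_add, add_comm]
    by_cases hskip : a ∈ Set.range f ∨ d a = 0
    · refine (ih hf hpos fun i hi => ?_).mono (by linarith [hd a])
      rcases ht i hi with hif | hit
      · exact Or.inl hif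
      · refine (Finset.mem_insert.1 hit).imp (fun hia => ?_) id
        subst hia
        exact hskip.resolve_right hi
    · obtain ⟨haf, hda⟩ := not_or.1 hskip
      set f' : Option ρ → τ := fun j => j.elim a f
      have hinj : f'.Injective := Option.injective_iff.2 ⟨hf, haf⟩
      have hpos' : ∀ j, 0 < d (f' j) :=
        Option.rec ((hd a).lt_of_ne' hda) hpos
      have hstep := (isBalancingPair_mul_sqrtInvSelection hLR hinj hpos').hasErrorGain_option
        hP.1 hQ.1 hpos' hc ho rfl
      have hfull := ih hinj hpos' fun i hi => by
        rcases ht i hi with ⟨j, rfl⟩ | hit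
        · exact Or.inl ⟨some j, rfl⟩
        · exact (Finset.mem_insert.1 hit).imp (fun hia => ⟨none, hia.symm⟩) id
      simp only [Matrix.mul_assoc, ← sqrtInvSelection_comp] at hstep hfull ⊢
      exact hfull.trans hstep

end Gain

end Factors

section FactorStability

theorem eq_zero_of_factors_separated {𝕜 : Type*} [Field 𝕜] [StarRing 𝕜] [DecidableEq τ]
    {ρ : Type*} {R L : Matrix ι τ 𝕜} {d : τ → 𝕜} (hLR : Lᴴ * R = diagonal d) {f : ρ → τ} {ν : 𝕜}
    (hν : ν ≠ 0) (hsep : ∀ i ∉ Set.range f, d i * star (d i) ≠ ν) {b : ι → 𝕜}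
    (hb : (R * Rᴴ) *ᵥ (L * Lᴴ) *ᵥ b = ν • b) (hLb : ∀ j, (Lᴴ *ᵥ b) (f j) = 0) : b = 0 := by
  have hRL : Rᴴ * L = diagonal (star d) := by
    simpa using congrArg conjTranspose hLR
  have hLb' : diagonal d *ᵥ diagonal (star d) *ᵥ Lᴴ *ᵥ b = ν • Lᴴ *ᵥ b := by
    rw [← mulVec_smul, ← hb, ← hLR, ← hRL]
    simp only [mulVec_mulVec, Matrix.mul_assoc]
  have hzero : Lᴴ *ᵥ b = 0 := by
    funext i
    by_cases hi : i ∈ Set.range f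
    · obtain ⟨j, rfl⟩ := hi
      exact hLb j
    · have := congrFun hLb' i
      rw [mulVec_diagonal, mulVec_diagonal, Pi.smul_apply, smul_eq_mul, ← mul_assoc] at this
      exact (mul_eq_mul_right_iff.1 this).resolve_left (hsep i hi)
  rw [← mulVec_mulVec b L, hzero, mulVec_zero, mulVec_zero] at hb
  exact (smul_eq_zero.1 hb.symm).resolve_left hν

theorem map_conjTranspose_sqrtInvSelection_mulVec [DecidableEq τ] {ρ : Type*} (d : τ → ℝ)
    (f : ρ → τ) (c : τ → ℂ) (j : ρ) :
    (((sqrtInvSelection d f).map (algebraMap ℝ ℂ))ᴴ *ᵥ c) j = (√(d (f j)) : ℂ)⁻¹ * c (f j) := by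
  rw [sqrtInvSelection, ← submatrix_map, diagonal_map (map_zero _), conjTranspose_submatrix,
    diagonal_conjTranspose, show ∀ M : Matrix τ τ ℂ, (M.submatrix f id *ᵥ c) j = (M *ᵥ c) (f j)
      from fun _ => rfl, mulVec_diagonal]
  simp

section

variable [DecidableEq ρ] [DecidableEq τ] {A : Matrix ι ι ℝ} {B : Matrix ι κ ℝ}
  {C : Matrix η ι ℝ} {R L : Matrix ι τ ℝ} {d : τ → ℝ} {f : ρ → τ}

theorem eq_zero_of_sqrtInvSelection_separated (hLR : Lᴴ * R = diagonal d) (hd : ∀ i, 0 ≤ d i)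
    (hpos : ∀ j, 0 < d (f j)) (hsep : ∀ i ∉ Set.range f, ∀ j, d i ≠ d (f j)) {ν : ℂ} {w : ρ → ℂ}
    {b : ι → ℂ} (hw : w ≠ 0)
    (hSw : (diagonal (d ∘ f)).map (algebraMap ℝ ℂ) *ᵥ (diagonal (d ∘ f)).map (algebraMap ℝ ℂ) *ᵥ w =
      ν • w)
    (hb : (R * Rᴴ).map (algebraMap ℝ ℂ) *ᵥ (L * Lᴴ).map (algebraMap ℝ ℂ) *ᵥ b = ν • b)
    (hWb : ((L * sqrtInvSelection d f).map (algebraMap ℝ ℂ))ᴴ *ᵥ b = 0) : b = 0 := by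
  have hφ : Function.Semiconj (algebraMap ℝ ℂ) star star := algebraMap_star_comm
  obtain ⟨j, hj⟩ := Function.ne_iff.1 hw
  have hν : (d (f j) : ℂ) * d (f j) = ν := by
    have := congrFun hSw j
    rw [diagonal_map (map_zero _), mulVec_diagonal, mulVec_diagonal, Pi.smul_apply, smul_eq_mul,
      ← mul_assoc] at this
    exact mul_right_cancel₀ hj this
  have hLRmap : (L.map (algebraMap ℝ ℂ))ᴴ * R.map (algebraMap ℝ ℂ) =
      diagonal (fun i => (d i : ℂ)) := by
    rw [← conjTranspose_map _ hφ, ← Matrix.map_mul, hLR, diagonal_map (map_zero _)]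
    rfl
  rw [Matrix.map_mul, Matrix.map_mul, conjTranspose_map _ hφ, conjTranspose_map _ hφ] at hb
  rw [Matrix.map_mul, Matrix.conjTranspose_mul, ← mulVec_mulVec] at hWb
  refine eq_zero_of_factors_separated hLRmap (f := f) ?_ (fun i hi => ?_) hb fun j => ?_
  · rw [← hν]
    exact_mod_cast (mul_pos (hpos j) (hpos j)).ne'
  · rw [← hν, Complex.star_def, Complex.conj_ofReal]
    exact_mod_cast fun h => hsep i hi j ((mul_self_inj_of_nonneg (hd i) (hpos j).le).1 h)
  · have hsqrt : (√(d (f j)) : ℂ)⁻¹ ≠ 0 :=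
      inv_ne_zero (Complex.ofReal_ne_zero.2 (Real.sqrt_pos.2 (hpos j)).ne')
    have hj := congrFun hWb j
    rw [map_conjTranspose_sqrtInvSelection_mulVec] at hj
    exact (mul_eq_zero.1 hj).resolve_left hsqrt

open scoped ComplexOrder in
theorem isAsymptoticallyStable_mul_sqrtInvSelection [DecidableEq ι]
    (hA : IsAsymptoticallyStable A) (hLR : Lᴴ * R = diagonal d) (hd : ∀ i, 0 ≤ d i)
    (hc : IsGramian A B (R * Rᴴ)) (ho : IsGramian Aᴴ Cᴴ (L * Lᴴ)) (hf : f.Injective)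
    (hpos : ∀ j, 0 < d (f j))
    (hsep : ∀ i ∉ Set.range f, ∀ j, d i ≠ d (f j)) :
    IsAsymptoticallyStable ((L * sqrtInvSelection d f)ᴴ * A * (R * sqrtInvSelection d f)) := by
  have hφ : Function.Semiconj (algebraMap ℝ ℂ) star star := algebraMap_star_comm
  rw [isAsymptoticallyStable_iff] at hA ⊢
  intro μ v hv hAv
  rw [Matrix.map_mul, Matrix.map_mul, conjTranspose_map _ hφ] at hAv
  have hbal := (isBalancingPair_mul_sqrtInvSelection hLR hf hpos).map _ hφ
  have ho' := ho.map _ hφ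
  rw [conjTranspose_map _ hφ, conjTranspose_map _ hφ] at ho'
  have hH : ∀ M : Matrix ι τ ℝ, ((M * Mᴴ).map (algebraMap ℝ ℂ)).IsHermitian := fun M =>
    (isHermitian_mul_conjTranspose_self M).map _ hφ
  have hS : ((diagonal (d ∘ f)).map (algebraMap ℝ ℂ)).PosDef := by
    rw [diagonal_map (map_zero _)]
    exact PosDef.diagonal fun j => by simpa using hpos j
  by_contra! hμ
  obtain ⟨w, hw, hAw⟩ := hbal.exists_eigenvector (hH R) (hH L) hS (hc.map _ hφ) ho'
    (fun _ _ _ => eq_zero_of_sqrtInvSelection_separated hLR hd hpos hsep) hv hAv hμ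
  exact hμ.not_gt (hA μ w hw hAw)

end

end FactorStability

namespace IsBalancedTruncation

variable {n m p r : ℕ} {A : Matrix (Fin n) (Fin n) ℝ} {B : Matrix (Fin n) (Fin m) ℝ}
  {C : Matrix (Fin p) (Fin n) ℝ} {V W : Matrix (Fin n) (Fin r) ℝ} {σ : ℕ → ℝ}

-- The orthogonal factors of the singular value decomposition are absorbed into `R` and `L`.
theorem exists_factors (h : IsBalancedTruncation A B C r V W σ) :
    ∃ (hr : r ≤ n) (R L : Matrix (Fin n) (Fin n) ℝ),
      Lᴴ * R = diagonal (fun i : Fin n => σ (i + 1)) ∧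
      IsGramian A B (R * Rᴴ) ∧ IsGramian Aᴴ Cᴴ (L * Lᴴ) ∧
      V = R * sqrtInvSelection (fun i : Fin n => σ (i + 1)) (Fin.castLE hr) ∧
      W = L * sqrtInvSelection (fun i : Fin n => σ (i + 1)) (Fin.castLE hr) := by
  obtain ⟨hr, P, Q, R, L, U, Z, hc, ho, rfl, rfl, hU, hZ, hsvd, -, -, -, rfl, rfl⟩ := h
  have hU' : Uᵀ * U = 1 := (mem_orthogonalGroup_iff' (Fin n) ℝ).1 hU
  have hZ' : Zᵀ * Z = 1 := (mem_orthogonalGroup_iff' (Fin n) ℝ).1 hZ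
  have hmul : ∀ {M N : Matrix (Fin n) (Fin n) ℝ}, N ∈ orthogonalGroup (Fin n) ℝ →
      M * N * (M * N)ᴴ = M * Mᵀ := by
    intro M N hN
    have hN' : N * Nᵀ = 1 := (mem_orthogonalGroup_iff (Fin n) ℝ).1 hN
    rw [conjTranspose_eq_transpose_of_trivial, transpose_mul, Matrix.mul_assoc,
      ← Matrix.mul_assoc N, hN', Matrix.one_mul]
  refine ⟨hr, R * Z, L * U, ?_, ?_, ?_, ?_, ?_⟩
  · calc (L * U)ᴴ * (R * Z) = Uᵀ * (Lᵀ * R) * Z := by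
          simp only [conjTranspose_eq_transpose_of_trivial, transpose_mul, Matrix.mul_assoc]
      _ = Uᵀ * U * diagonal (fun i : Fin n => σ (i + 1)) * (Zᵀ * Z) := by
          simp only [hsvd, Matrix.mul_assoc]
      _ = diagonal (fun i : Fin n => σ (i + 1)) := by
          rw [hU', hZ', Matrix.one_mul, Matrix.mul_one]
  · rwa [hmul hZ]
  · rw [hmul hU, IsGramian, conjTranspose_conjTranspose, conjTranspose_conjTranspose]
    exact ho
  · rw [Matrix.mul_assoc R Z, mul_sqrtInvSelection, Matrix.mul_assoc]
    rfl
  · rw [Matrix.mul_assoc L U, mul_sqrtInvSelection, Matrix.mul_assoc]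
    rfl

theorem nonneg (h : IsBalancedTruncation A B C r V W σ) (i : ℕ) : 0 ≤ σ i := by
  obtain ⟨-, -, -, -, -, -, -, -, -, -, -, -, -, -, h, -⟩ := h
  exact h i

theorem le_of_le (h : IsBalancedTruncation A B C r V W σ) {i j : ℕ} (hi : 1 ≤ i) (hij : i ≤ j) :
    σ j ≤ σ i := by
  obtain ⟨-, -, -, -, -, -, -, -, -, -, -, -, -, -, -, h, -⟩ := h
  exact h i j hi hij

theorem two_mul_sum_nonneg (h : IsBalancedTruncation A B C r V W σ) (s : Finset ℕ) :
    0 ≤ 2 * ∑ i ∈ s, σ i :=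
  mul_nonneg zero_le_two (Finset.sum_nonneg fun i _ => h.nonneg i)

theorem lt_of_gap (h : IsBalancedTruncation A B C r V W σ) (hσ : σ (r + 1) < σ r) {i j : ℕ}
    (hi : r ≤ i) (hj : j < r) : σ (i + 1) < σ (j + 1) :=
  calc σ (i + 1) ≤ σ (r + 1) := h.le_of_le (by lia) (by lia)
    _ < σ r := hσ
    _ ≤ σ (j + 1) := h.le_of_le (by lia) (by lia)

theorem pos_of_gap (h : IsBalancedTruncation A B C r V W σ) (hσ : σ (r + 1) < σ r) {j : ℕ}
    (hj : j < r) : 0 < σ (j + 1) :=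
  (h.nonneg (r + 1)).trans_lt (h.lt_of_gap hσ le_rfl hj)

theorem isAsymptoticallyStable (h : IsBalancedTruncation A B C r V W σ)
    (hA : IsAsymptoticallyStable A) (hσ : σ (r + 1) < σ r) :
    IsAsymptoticallyStable (redA A V W) := by
  obtain ⟨hr, R, L, hLR, hc, ho, hV, hW⟩ := h.exists_factors
  have hsep : ∀ i ∉ Set.range (Fin.castLE hr), ∀ j : Fin r,
      σ (i + 1) ≠ σ (Fin.castLE hr j + 1) := by
    intro i hi j
    rw [Fin.range_castLE] at hi
    exact (h.lt_of_gap hσ (not_lt.1 hi) j.2).ne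
  rw [redA, ← conjTranspose_eq_transpose_of_trivial, hV, hW]
  exact isAsymptoticallyStable_mul_sqrtInvSelection hA hLR (fun _ => h.nonneg _) hc ho
    (Fin.castLE_injective hr) (fun j => h.pos_of_gap hσ j.2) hsep

theorem hasErrorGain (h : IsBalancedTruncation A B C r V W σ) (hσ : σ (r + 1) < σ r) :
    HasErrorGain A B C (redA A V W) (Wᵀ * B) (C * V) (2 * ∑ i ∈ Finset.Icc (r + 1) n, σ i) := by
  obtain ⟨hr, R, L, hLR, hc, ho, hV, hW⟩ := h.exists_factors
  have hsum : ∑ i : Fin n with r ≤ i.val, σ (i + 1) = ∑ i ∈ Finset.Icc (r + 1) n, σ i := by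
    rw [Finset.sum_filter, Fin.sum_univ_eq_sum_range (fun i => if r ≤ i then σ (i + 1) else 0),
      ← Finset.sum_filter]
    refine Finset.sum_bij' (fun i _ => i + 1) (fun i _ => i - 1) ?_ ?_ ?_ ?_ ?_ <;> grind
  have hcover : ∀ i : Fin n,
      i ∈ Set.range (Fin.castLE hr) ∨ i ∈ ({i | r ≤ i.val} : Finset (Fin n)) := by
    simpa using fun i : Fin n => lt_or_ge (i : ℕ) r
  rw [redA, ← conjTranspose_eq_transpose_of_trivial, hV, hW, ← hsum]
  exact hasErrorGain_mul_sqrtInvSelection hLR (fun _ => h.nonneg _) hc ho _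
    (Fin.castLE_injective hr) (fun j => h.pos_of_gap hσ j.2) fun i _ => hcover i

end IsBalancedTruncation

section FreeResponse

variable [DecidableEq ι] {A : Matrix ι ι ℝ} {B : Matrix ι κ ℝ} {C : Matrix η ι ℝ}
  {u : ℝ → τ → ℝ} {x₀ : ι → ℝ} {x : ℝ → ι → ℝ} {α : ℝ}

theorem IsTrajectory.sub_exp (hx : IsTrajectory A (0 : Matrix ι τ ℝ) u x₀ x) {c : ℝ} {z : κ → ℝ}
    (hB : c • B *ᵥ z = (A + α • (1 : Matrix ι ι ℝ)) *ᵥ x₀) :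
    IsTrajectory A B (fun t => (c * Real.exp (-α * t)) • z) 0
      (fun t => x t - Real.exp (-α * t) • x₀) := by
  have hexp : IsPrimitive (fun t => (-α * Real.exp (-α * t)) • x₀)
      fun t => Real.exp (-α * t) • x₀ := by
    refine .of_hasDerivAt (by fun_prop) fun t => HasDerivAt.smul_const ?_ x₀
    simpa [mul_comm] using ((hasDerivAt_id t).const_mul (-α)).exp
  refine isTrajectory_iff.2 ⟨by simp [hx.apply_zero], (hx.isPrimitive.sub hexp).congr fun t _ => ?_⟩
  rw [mulVec_smul, mul_comm c, mul_smul, hB, mulVec_sub, mulVec_smul, add_mulVec, smul_mulVec,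
    one_mulVec, zero_mulVec]
  module

theorem HasErrorGain.free_response [DecidableEq ρ] {A' : Matrix ρ ρ ℝ} {B' : Matrix ρ κ ℝ}
    {C' : Matrix η ρ ℝ} {γ : ℝ} (h : HasErrorGain A B C A' B' C' γ) (hγ : 0 ≤ γ) (hα : 0 < α)
    {z : κ → ℝ} {x₀' : ρ → ℝ} {x' : ℝ → ρ → ℝ}
    (hB : √(2 * α) • B *ᵥ z = (A + α • (1 : Matrix ι ι ℝ)) *ᵥ x₀)
    (hB' : √(2 * α) • B' *ᵥ z = (A' + α • (1 : Matrix ρ ρ ℝ)) *ᵥ x₀')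
    (hx : IsTrajectory A (0 : Matrix ι τ ℝ) u x₀ x)
    (hx' : IsTrajectory A' (0 : Matrix ρ τ ℝ) u x₀' x') :
    NormL2LE (fun t => C *ᵥ (x t - Real.exp (-α * t) • x₀) -
      C' *ᵥ (x' t - Real.exp (-α * t) • x₀')) (γ * ‖WithLp.toLp 2 z‖) := by
  have hv := normL2LE_exp_smul hα z
  exact (h hv.1 (hx.sub_exp hB) (hx'.sub_exp hB')).mono (mul_le_mul_of_nonneg_left hv.2 hγ)

variable {ρ' : Type*} [Fintype ρ'] [DecidableEq ρ'] {A₁ : Matrix ρ ρ ℝ} {B₁ : Matrix ρ τ ℝ}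
  {C₁ : Matrix η ρ ℝ} {x₁ : ℝ → ρ → ℝ} {A₂ : Matrix ρ' ρ' ℝ} {B₂ : Matrix ρ' κ ℝ}
  {C₂ : Matrix η ρ' ℝ} {y₀ : ρ' → ℝ} {x₂ : ℝ → ρ' → ℝ} {γ₁ γ₂ : ℝ}

theorem HasErrorGain.superposition {B' : Matrix ι τ ℝ} (h₁ : HasErrorGain A B' C A₁ B₁ C₁ γ₁)
    (h₂ : HasErrorGain A B C A₂ B₂ C₂ γ₂) (hγ₂ : 0 ≤ γ₂) (hα : 0 < α) (hu : MemL2 u) {z : κ → ℝ}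
    (hB : √(2 * α) • B *ᵥ z = (A + α • (1 : Matrix ι ι ℝ)) *ᵥ x₀)
    (hB₂ : √(2 * α) • B₂ *ᵥ z = (A₂ + α • (1 : Matrix ρ' ρ' ℝ)) *ᵥ y₀)
    (hx : IsTrajectory A B' u x₀ x) (hx₁ : IsTrajectory A₁ B₁ u 0 x₁)
    (hx₂ : IsTrajectory A₂ (0 : Matrix ρ' τ ℝ) u y₀ x₂) :
    NormL2LE (fun t => C *ᵥ x t - (C₁ *ᵥ x₁ t + C₂ *ᵥ x₂ t +
      Real.exp (-α * t) • (C *ᵥ x₀ - C₂ *ᵥ y₀))) (γ₁ * normL2 u + γ₂ * ‖WithLp.toLp 2 z‖) := by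
  obtain ⟨ζ, hζ⟩ := exists_isTrajectory_zero A B' hu.intervalIntegrable
  have hfree := hx.sub hζ
  rw [sub_zero] at hfree
  refine ((h₁ hu hζ hx₁).add (h₂.free_response hγ₂ hα hB hB₂ hfree hx₂)).congr fun t _ => ?_
  simp only [mulVec_sub, mulVec_smul, smul_sub]
  abel

end FreeResponse

section ShiftedInput

variable {n q l : ℕ} {A : Matrix (Fin n) (Fin n) ℝ} {X₀ : Matrix (Fin n) (Fin q) ℝ} {α : ℝ}
  {V W : Matrix (Fin n) (Fin l) ℝ}

theorem sqrt_smul_shiftedInput (hα : 0 < α) :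
    √(2 * α) • shiftedInput A X₀ α = (A + α • (1 : Matrix (Fin n) (Fin n) ℝ)) * X₀ := by
  have hsqrt : √(2 * α) ≠ 0 := by positivity
  rw [shiftedInput, smul_smul, mul_one_div_cancel hsqrt, one_smul]

theorem isUnit_det_add_smul_one {K : Type*} [Field K] [DecidableEq ι] {A : Matrix ι ι K} {α : K}
    (h : ¬ Module.End.HasEigenvalue (toLin' A) (-α)) :
    IsUnit (A + α • (1 : Matrix ι ι K)).det := by
  refine isUnit_iff_ne_zero.2 fun hdet => ?_
  obtain ⟨v, hv, hv0⟩ := exists_mulVec_eq_zero_iff.2 hdet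
  rw [add_mulVec, smul_mulVec, one_mulVec] at hv0
  refine h (Module.End.hasEigenvalue_of_hasEigenvector (x := v)
    (Module.End.hasEigenvector_iff.2 ⟨Module.End.mem_eigenspace_iff.2 ?_, hv⟩))
  rw [toLin'_apply, neg_smul]
  exact eq_neg_of_add_eq_zero_left hv0

theorem sqrt_smul_transpose_mul_shiftedInput (hα : 0 < α)
    (h : ¬ Module.End.HasEigenvalue (toLin' (redA A V W)) (-α)) :
    √(2 * α) • (Wᵀ * shiftedInput A X₀ α) =
      (redA A V W + α • (1 : Matrix (Fin l) (Fin l) ℝ)) * redX₀ A X₀ α V W := by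
  simp only [redX₀, Matrix.mul_assoc]
  rw [mul_nonsing_inv_cancel_left _ _ (isUnit_det_add_smul_one h), ← Matrix.mul_smul,
    sqrt_smul_shiftedInput hα]

end ShiftedInput

end ShiftBT

theorem theorem2 {n m p q k l : ℕ}
    (A : Matrix (Fin n) (Fin n) ℝ) (B : Matrix (Fin n) (Fin m) ℝ)
    (C : Matrix (Fin p) (Fin n) ℝ) (D : Matrix (Fin p) (Fin m) ℝ)
    (X₀ : Matrix (Fin n) (Fin q) ℝ)
    (hA : ShiftBT.IsAsymptoticallyStable A)
    (α : ℝ) (hα : 0 < α)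
    (hk : 1 ≤ k) (hl : 1 ≤ l)
    (V W : Matrix (Fin n) (Fin k) ℝ) (σ : ℕ → ℝ)
    (hBT : ShiftBT.IsBalancedTruncation A B C k V W σ)
    (V' W' : Matrix (Fin n) (Fin l) ℝ) (θ : ℕ → ℝ)
    (hBT' : ShiftBT.IsBalancedTruncation A (ShiftBT.shiftedInput A X₀ α) C l V' W' θ)
    (hσ : σ k > σ (k + 1)) (hθ : θ l > θ (l + 1))
    (hev : ¬ Module.End.HasEigenvalue (Matrix.toLin' (ShiftBT.redA A V' W')) (-α)) :
    ShiftBT.IsAsymptoticallyStable (ShiftBT.romA A V W V' W') ∧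
    ∀ (z₀ : Fin q → ℝ) (u : ℝ → Fin m → ℝ) (x : ℝ → Fin n → ℝ) (xr : ℝ → Fin k ⊕ Fin l → ℝ)
      (y yr : ℝ → Fin p → ℝ),
      ShiftBT.IsTrajectory A B u (X₀ *ᵥ z₀) x →
      ShiftBT.IsTrajectory (ShiftBT.romA A V W V' W') (ShiftBT.romB l B W) u
        (ShiftBT.romInit k A X₀ α V' W' z₀) xr →
      (∀ t, 0 ≤ t → y t = C *ᵥ x t + D *ᵥ u t) →
      (∀ t, 0 ≤ t → yr t = ShiftBT.romC C V V' *ᵥ xr t + D *ᵥ u t +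
        Real.exp (-α * t) • (ShiftBT.redF A C X₀ α V' W' *ᵥ z₀)) →
      yr 0 = y 0 ∧
      (ShiftBT.MemL2 u →
        ShiftBT.MemL2 (fun t => y t - yr t) ∧
        ShiftBT.normL2 (fun t => y t - yr t) ≤
          2 * (∑ i ∈ Finset.Icc (k + 1) n, σ i) * ShiftBT.normL2 u +
          2 * (∑ i ∈ Finset.Icc (l + 1) n, θ i) * ‖WithLp.toLp 2 z₀‖) := by
  refine ⟨ShiftBT.isAsymptoticallyStable_fromBlocks_diagonal (hBT.isAsymptoticallyStable hA hσ)
    (hBT'.isAsymptoticallyStable hA hθ), ?_⟩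
  intro z₀ u x xr y yr hx hxr hy hyr
  have hxk := hxr.inl
  have hxl := hxr.inr
  have hromC : ∀ t, ShiftBT.romC C V V' *ᵥ xr t =
      (C * V) *ᵥ (xr t ∘ Sum.inl) + (C * V') *ᵥ (xr t ∘ Sum.inr) :=
    fun t => fromCols_mulVec _ _ _
  have hF : ShiftBT.redF A C X₀ α V' W' *ᵥ z₀ =
      C *ᵥ (X₀ *ᵥ z₀) - (C * V') *ᵥ (ShiftBT.redX₀ A X₀ α V' W' *ᵥ z₀) := by
    rw [ShiftBT.redF, sub_mulVec, mulVec_mulVec, mulVec_mulVec]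
  refine ⟨?_, fun hu => ?_⟩
  · rw [hy 0 le_rfl, hyr 0 le_rfl, hromC, hF, hx.apply_zero, hxk.apply_zero, hxl.apply_zero]
    simp only [mulVec_zero, mul_zero, Real.exp_zero, one_smul]
    abel
  · have herror := (hBT.hasErrorGain hσ).superposition (hBT'.hasErrorGain hθ)
      (hBT'.two_mul_sum_nonneg _) hα hu (z := z₀)
      (by rw [← smul_mulVec, ShiftBT.sqrt_smul_shiftedInput hα, ← mulVec_mulVec])
      (by rw [← smul_mulVec, ShiftBT.sqrt_smul_transpose_mul_shiftedInput hα hev, ← mulVec_mulVec])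
      hx hxk hxl
    refine herror.congr fun t ht => ?_
    rw [hy t ht, hyr t ht, hromC, hF]
    abel
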